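/- Let $k,l>0$. Let $C$ be a cylinder with baseline $\gamma$ of length $l$: $\gamma$ is a geodesic arc of length $l$ in a smooth simply connected Riemannian surface, $S$ is the strip swept out by the geodesic arcs perpendicular to $\gamma$, taken over the directed distances $s\in(a,b)$ from $\gamma$, where $-\infty\le a\le 0\le b\le\infty$ and $a<b$, and $C$ is obtained from $S$ by identifying its two sides over the endpoints of $\gamma$ by an orientation preserving isometry of the surface. Thus $C$ has Fermi coordinates $(t,s)\in\mathbb R/l\mathbb Z\times(a,b)$; at a finite end $a$ or $b$ the surface continues beyond the strip, and closures are taken in the closed cylinder ($a\le s\le b$, $s$ finite). Suppose that the Gaussian curvature of $C$, which may vary, is at most $-k^2$ everywhere. A non-contractible annulus in $C$ is a set $A=J(C,1)$, where $J:C\times[0,1]\to C$ is an isotopy (continuous, each $J(\cdot,\tau)$ a topological embedding) with $J(\cdot,0)=\mathrm{id}$. Its boundary components $\partial_1A$ and $\partial_2A$ are the sets of limit points of $J((t,s),1)$ as $s\to a$ and as $s\to b$, respectively. Its capacity is $$\operatorname{cap}(A)=\inf\Big\{\int_A\|dF\|^2\,d\mathrm{area}\ :\ F\in\mathrm{Lip}(\bar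 A),\ F|_{\partial_1A}=0,\ F|_{\partial_2A}=1\Big\}\in[0,\infty],$$ where $\mathrm{Lip}(\bar A)$ is the set of functions on $\bar A$ that are Lipschitz for the Riemannian distance of the closed cylinder. Put $h_1(x)=2\arctan(e^x)$. (1) Every non-contractible annulus $A\subset C$ of finite area satisfies $$\operatorname{cap}(A)\ \ge\ \frac{k\,l}{h_1(W')-h_1(-W')},\qquad W'=\operatorname{arcsinh}\Big(\frac{k\cdot\operatorname{area}(A)}{2l}\Big).$$ (2) The bound is sharp in constant curvature: if the curvature of $C$ is constant, equal to $-k^2$, then for every $w>0$ with $a\le -w$ and $w\le b$ the set $A_w=\{(t,s): |s|<w\}$ of constant width centred on the baseline is a non-contractible annulus of finite area with boundary components $\{s=-w\}$ and $\{s=w\}$, and equality holds in (1) for $A=A_w$. -/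

import Mathlib

open scoped ContDiff ENNReal NNReal

noncomputable section

/-! ### Riemannian metrics on open subsets of the coordinate plane

A metric tensor is a field `G` of symmetric positive definite `2 × 2` matrices. The two coordinates
`(t, s)` of a point of `ℝ × ℝ` have the indices `0` and `1`. -/

/-- The `i`-th coordinate of a point or a vector of the plane. -/
def coord (i : Fin 2) (p : ℝ × ℝ) : ℝ := ![p.1, p.2] i

/-- The `i`-th partial derivative of `f` at `p`. -/
def pd (i : Fin 2) (f : ℝ × ℝ → ℝ) (p : ℝ × ℝ) : ℝ :=
  fderiv ℝ f p (![((1 : ℝ), (0 : ℝ)), ((0 : ℝ), (1 : ℝ))] i)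

/-- The scalar product `G_p(v, w)` of two tangent vectors at `p`. -/
def metricInner (G : ℝ × ℝ → Matrix (Fin 2) (Fin 2) ℝ) (p v w : ℝ × ℝ) : ℝ :=
  ∑ i, ∑ j, G p i j * coord i v * coord j w

/-- The Christoffel symbol `Γ^m_{ij}` of `G` at `p`. -/
def christoffel (G : ℝ × ℝ → Matrix (Fin 2) (Fin 2) ℝ) (m i j : Fin 2) (p : ℝ × ℝ) : ℝ :=
  (1 / 2) * ∑ n, (G p)⁻¹ m n *
    (pd i (fun q => G q j n) p + pd j (fun q => G q i n) p - pd n (fun q => G q i j) p)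

/-- The curvature coefficient `R^m_{nij}`, where `R(∂_i, ∂_j) ∂_n = ∑ m, R^m_{nij} ∂_m`. -/
def riemannCoeff (G : ℝ × ℝ → Matrix (Fin 2) (Fin 2) ℝ) (m n i j : Fin 2) (p : ℝ × ℝ) : ℝ :=
  pd i (christoffel G m j n) p - pd j (christoffel G m i n) p +
    ∑ q, (christoffel G m i q p * christoffel G q j n p -
      christoffel G m j q p * christoffel G q i n p)

/-- The Gaussian curvature `⟨R(∂_0, ∂_1) ∂_1, ∂_0⟩ / det G` of `G` at `p`. -/
def gaussCurvature (G : ℝ × ℝ → Matrix (Fin 2) (Fin 2) ℝ) (p : ℝ × ℝ) : ℝ :=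
  (∑ m, G p 0 m * riemannCoeff G m 1 0 1 p) / (G p).det

/-- The curve `c` is a geodesic of unit speed for the parameters in `T`. -/
def IsUnitSpeedGeodesicOn (G : ℝ × ℝ → Matrix (Fin 2) (Fin 2) ℝ) (c : ℝ → ℝ × ℝ)
    (T : Set ℝ) : Prop :=
  ∀ τ ∈ T, ContDiffAt ℝ 2 c τ ∧ metricInner G (c τ) (deriv c τ) (deriv c τ) = 1 ∧
    ∀ m, coord m (deriv (deriv c) τ) +
      ∑ i, ∑ j, christoffel G m i j (c τ) * coord i (deriv c τ) * coord j (deriv c τ) = 0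

/-! ### Cylinders -/

/-- A cylinder with a baseline of length `l`, in Fermi coordinates `(t, s)`.

The surface is the simply connected strip `ℝ × U` with the metric `G`. The baseline is the arc
`0 ≤ t ≤ l` of the unit speed geodesic `t ↦ (t, 0)`; the point `(t, s)` is reached from `(t, 0)` by
going the directed distance `s` along the geodesic `s ↦ (t, s)`, which is perpendicular to the
baseline. The isometry that identifies the two sides `t = 0` and `t = l` of the strip
`[0, l] × (a, b)` is the translation `(t, s) ↦ (t + l, s)`. The ends `a` and `b` may be infinite; at
a finite end the surface reaches beyond the boundary of the strip. -/
structure Cylinder (l : ℝ) where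
  /-- The lower end. -/
  a : EReal
  /-- The upper end. -/
  b : EReal
  /-- The range of the coordinate `s` on the surface. -/
  U : Set ℝ
  /-- The metric tensor. -/
  G : ℝ × ℝ → Matrix (Fin 2) (Fin 2) ℝ
  a_lt_b : a < b
  a_le : a ≤ 0
  le_b : 0 ≤ b
  isOpen_U : IsOpen U
  ordConnected_U : U.OrdConnected
  mem_U : ∀ s : ℝ, a ≤ (s : EReal) → (s : EReal) ≤ b → s ∈ U
  smooth : ∀ i j, ContDiffOn ℝ ∞ (fun p => G p i j) (Set.univ ×ˢ U)
  posDef : ∀ t : ℝ, ∀ s ∈ U, (G (t, s)).PosDef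
  periodic : ∀ t : ℝ, ∀ s ∈ U, G (t + l, s) = G (t, s)
  baseline : IsUnitSpeedGeodesicOn G (fun t => (t, 0)) Set.univ
  perpendicular : ∀ t : ℝ, metricInner G (t, 0) (1, 0) (0, 1) = 0
  fiber : ∀ t : ℝ, IsUnitSpeedGeodesicOn G (fun s => (t, s))
    {s : ℝ | a ≤ (s : EReal) ∧ (s : EReal) ≤ b}

namespace Cylinder

variable {l : ℝ}

/-- The set of points of the (open) cylinder, in `(ℝ / l ℤ) × ℝ`. -/
def carrier (C : Cylinder l) : Set (AddCircle l × ℝ) :=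
  {p | C.a < (p.2 : EReal) ∧ (p.2 : EReal) < C.b}

/-- `A` is a non-contractible annulus on `C` with the boundary components `B₁` (below) and `B₂`
(above): an isotopy of `C` in itself, from the identity to an embedding with image `A`. The boundary
component `B₁` consists of the limit points of the images of the points `(t, s)` as `s` tends to the
lower end of `C`, and `B₂` of those as `s` tends to the upper end; closures are taken in the closed
cylinder. -/
def IsAnnulus (C : Cylinder l) (A B₁ B₂ : Set (AddCircle l × ℝ)) : Prop :=
  ∃ J : unitInterval → C.carrier → C.carrier,
    Continuous (fun x : unitInterval × C.carrier => J x.1 x.2) ∧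
    (∀ τ, Topology.IsEmbedding (J τ)) ∧
    (∀ x, J 0 x = x) ∧
    A = Set.range (fun x => (J 1 x : AddCircle l × ℝ)) ∧
    B₁ = ⋂ c ∈ {c : ℝ | C.a < (c : EReal) ∧ (c : EReal) < C.b},
      closure ((fun x => (J 1 x : AddCircle l × ℝ)) '' {x : C.carrier | x.1.2 < c}) ∧
    B₂ = ⋂ c ∈ {c : ℝ | C.a < (c : EReal) ∧ (c : EReal) < C.b},
      closure ((fun x => (J 1 x : AddCircle l × ℝ)) '' {x : C.carrier | c < x.1.2})

/-- The coordinates in `[0, l) × ℝ` of the points of `A`. -/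
def coordSet (A : Set (AddCircle l × ℝ)) : Set (ℝ × ℝ) :=
  {p | 0 ≤ p.1 ∧ p.1 < l ∧ ((p.1 : AddCircle l), p.2) ∈ A}

/-- The Riemannian area of `A`. -/
def area (C : Cylinder l) (A : Set (AddCircle l × ℝ)) : ℝ≥0∞ :=
  ∫⁻ p in coordSet A, ENNReal.ofReal (Real.sqrt (C.G p).det)

/-- The energy of `F` on `A`: the integral of the squared norm of the differential. -/
def energy (C : Cylinder l) (A : Set (AddCircle l × ℝ)) (F : AddCircle l × ℝ → ℝ) : ℝ≥0∞ :=
  ∫⁻ p in coordSet A, ENNReal.ofReal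
    ((∑ i, ∑ j, (C.G p)⁻¹ i j * pd i (fun q => F ((q.1 : AddCircle l), q.2)) p *
        pd j (fun q => F ((q.1 : AddCircle l), q.2)) p) * Real.sqrt (C.G p).det)

/-- The Riemannian length of the part of `c` over `[0, 1]`. -/
def pathLength (C : Cylinder l) (c : ℝ → ℝ × ℝ) : ℝ≥0∞ :=
  ∫⁻ τ in Set.Icc (0 : ℝ) 1,
    ENNReal.ofReal (Real.sqrt (metricInner C.G (c τ) (deriv c τ) (deriv c τ)))

/-- The Riemannian distance on the closed cylinder: the infimum of the lengths of the `C¹` paths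
from `x` to `y` in it. A path is given by its lift to the coordinate plane. -/
def dist (C : Cylinder l) (x y : AddCircle l × ℝ) : ℝ≥0∞ :=
  ⨅ (c : ℝ → ℝ × ℝ) (_ : ContDiff ℝ 1 c)
    (_ : ∀ τ ∈ Set.Icc (0 : ℝ) 1, C.a ≤ ((c τ).2 : EReal) ∧ ((c τ).2 : EReal) ≤ C.b)
    (_ : (((c 0).1 : AddCircle l), (c 0).2) = x) (_ : (((c 1).1 : AddCircle l), (c 1).2) = y),
    C.pathLength c

/-- `F` is Lipschitz on `X` for the Riemannian distance. -/
def IsLip (C : Cylinder l) (X : Set (AddCircle l × ℝ)) (F : AddCircle l × ℝ → ℝ) : Prop :=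
  ∃ L : ℝ≥0, ∀ x ∈ X, ∀ y ∈ X, edist (F x) (F y) ≤ L * C.dist x y

/-- The capacity of the annulus `A` with the boundary components `B₁` and `B₂`. -/
def capacity (C : Cylinder l) (A B₁ B₂ : Set (AddCircle l × ℝ)) : ℝ≥0∞ :=
  ⨅ (F : AddCircle l × ℝ → ℝ) (_ : C.IsLip (closure A) F) (_ : ∀ x ∈ B₁, F x = 0)
    (_ : ∀ x ∈ B₂, F x = 1), C.energy A F

end Cylinder

/-- The function `2 arctan (exp x)`. -/
def h₁ (x : ℝ) : ℝ := 2 * Real.arctan (Real.exp x)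

/-- The number `k l / (h₁ W - h₁ (-W))`, where `W = arsinh (k α / (2 l))`. -/
def capacityBound (k l α : ℝ) : ℝ :=
  k * l / (h₁ (Real.arsinh (k * α / (2 * l))) - h₁ (-Real.arsinh (k * α / (2 * l))))

end

noncomputable section

/-! ### Comparison of solutions of a Riccati equation -/

/-! In Fermi coordinates the metric is `f² dt² + ds²` with `f = √(G 0 0)`. The geodesic equations
force this form (`metric_eq`), and the curvature is `-u' - u²` for `u = f'/f` (`gaussCurvature_eq`).
Since `f = 1` and `u = 0` on the baseline, Riccati comparison gives `f ≥ cosh (k s)` when the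
curvature is at most `-k²` (`lengthElement_comparison`).

Let `F` be admissible for `A`. The energy is at least `∫ (∂ₛF)² f dt ds` over `A`. On almost every
vertical line `F` takes all values in `(0, 1)` inside `A`, so `∫ |∂ₛF| ds ≥ 1` there and `l ≤ ∫
|∂ₛF| dt ds` over `A` (`ofReal_le_lintegral_abs_pd`). The crossing is topological: a winding number
argument (`exists_eq_on_fiber`) is applied to images of horizontal circles near the two ends. At
infinite ends this requires that the line meet `A` in finite length (`exists_level_lt`), which
finite area guarantees for almost every line because `f ≥ 1`. That `A` is open is an instance of
invariance of domain, also proved by winding numbers (`isOpen_range_of_isotopy`).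

Integrating `2|x| ≤ I x² f + 1/(I f)` at `x = ∂ₛF` reduces the problem to bounding `∫ 1/f dt ds`
over `A` when `∫ f dt ds = area A` is given. The bathtub inequality (`inv_le_of_cosh_le`) shows that
the worst case is the collar `|s| ≤ W'/k` in curvature `-k²`, whose area is that of `A`. There the
integral is `l N / k` with `N = h₁ W' - h₁ (-W')`, and `I = N / k` gives the bound.

In constant curvature `f = cosh (k s)`, and the affine function of `h₁ (k s)` with boundary values
`0` and `1` has exactly the energy of the bound (`energy_collarPotential`). -/

/-- Sturm's argument: the Wronskian of `f` and `cosh (k s)` is monotone, and it is the numerator of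
the derivative of `f / cosh (k s)`. The factor `ε` lets one proof serve both directions of the
comparison. -/
theorem riccati_comparison_of_nonneg {k ε s₀ : ℝ} {f u u' : ℝ → ℝ} (hs₀ : 0 ≤ s₀)
    (hf : ∀ s ∈ Set.Icc 0 s₀, HasDerivAt f (u s * f s) s) (hpos : ∀ s ∈ Set.Icc 0 s₀, 0 < f s)
    (hu : ContinuousOn u (Set.Icc 0 s₀)) (hu' : ∀ s ∈ Set.Ioo 0 s₀, HasDerivAt u (u' s) s)
    (h : ∀ s ∈ Set.Ioo 0 s₀, 0 ≤ ε * (u' s + u s ^ 2 - k ^ 2)) (hf0 : f 0 = 1) (hu0 : u 0 = 0) :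
    0 ≤ ε * (f s₀ - Real.cosh (k * s₀)) := by
  have hcosh : ∀ s, HasDerivAt (fun s => Real.cosh (k * s)) (Real.sinh (k * s) * k) s := fun s => by
    simpa using ((hasDerivAt_id s).const_mul k).cosh
  have hsinh : ∀ s, HasDerivAt (fun s => Real.sinh (k * s)) (Real.cosh (k * s) * k) s := fun s => by
    simpa using ((hasDerivAt_id s).const_mul k).sinh
  have hfc : ContinuousOn f (Set.Icc 0 s₀) := fun s hs => (hf s hs).continuousAt.continuousWithinAt
  -- This is `ε` times the Wronskian `f' cosh - f cosh'`, with `f' = u f` substituted.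
  let y : ℝ → ℝ := fun s => ε * (f s * (u s * Real.cosh (k * s) - k * Real.sinh (k * s)))
  have hy : MonotoneOn y (Set.Icc 0 s₀) := by
    refine monotoneOn_of_hasDerivWithinAt_nonneg (convex_Icc 0 s₀)
      (f' := fun s => f s * Real.cosh (k * s) * (ε * (u' s + u s ^ 2 - k ^ 2))) ?_ ?_ ?_
    · exact continuousOn_const.mul (hfc.mul ((hu.mul (by fun_prop)).sub (by fun_prop)))
    · rw [interior_Icc]
      intro s hs
      have h1 := ((hf s (Set.Ioo_subset_Icc_self hs)).mul
        (((hu' s hs).mul (hcosh s)).sub ((hsinh s).const_mul k))).const_mul ε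
      refine (h1.congr_deriv ?_).hasDerivWithinAt
      simp only [Pi.sub_apply, Pi.mul_apply]
      ring
    · rw [interior_Icc]
      intro s hs
      have := hpos s (Set.Ioo_subset_Icc_self hs)
      have := h s hs
      have := Real.cosh_pos (k * s)
      positivity
  have hy0 : ∀ s ∈ Set.Icc 0 s₀, 0 ≤ y s := fun s hs => by
    have := hy ⟨le_rfl, hs₀⟩ hs hs.1
    simpa [y, hu0] using this
  have hg : MonotoneOn (fun s => ε * (f s / Real.cosh (k * s))) (Set.Icc 0 s₀) := by
    refine monotoneOn_of_hasDerivWithinAt_nonneg (convex_Icc 0 s₀)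
      (f' := fun s => y s / Real.cosh (k * s) ^ 2) ?_ ?_ ?_
    · exact continuousOn_const.mul (hfc.div (by fun_prop) fun s _ => (Real.cosh_pos _).ne')
    · rw [interior_Icc]
      intro s hs
      have h1 := (((hf s (Set.Ioo_subset_Icc_self hs)).div (hcosh s)
        (Real.cosh_pos _).ne')).const_mul ε
      refine (h1.congr_deriv ?_).hasDerivWithinAt
      simp only [y]
      ring
    · rw [interior_Icc]
      intro s hs
      exact div_nonneg (hy0 s (Set.Ioo_subset_Icc_self hs)) (sq_nonneg _)
  have h1 := hg ⟨le_rfl, hs₀⟩ ⟨hs₀, le_rfl⟩ hs₀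
  simp only [mul_zero, Real.cosh_zero, hf0, div_one, mul_one] at h1
  have hc := Real.cosh_pos (k * s₀)
  have h2 : ε * (f s₀ - Real.cosh (k * s₀)) =
      (ε * (f s₀ / Real.cosh (k * s₀)) - ε) * Real.cosh (k * s₀) := by
    field_simp
  rw [h2]
  exact mul_nonneg (sub_nonneg.2 h1) hc.le

/-- Negative `s₀` reduces to the positive case by reflection `s ↦ -s`, under which the logarithmic
derivative `u` changes sign. -/
theorem riccati_comparison {k ε s₀ : ℝ} {f u u' : ℝ → ℝ}
    (hf : ∀ s ∈ Set.uIcc 0 s₀, HasDerivAt f (u s * f s) s) (hpos : ∀ s ∈ Set.uIcc 0 s₀, 0 < f s)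
    (hu : ContinuousOn u (Set.uIcc 0 s₀))
    (hu' : ∀ s ∈ Set.uIoo 0 s₀, HasDerivAt u (u' s) s)
    (h : ∀ s ∈ Set.uIoo 0 s₀, 0 ≤ ε * (u' s + u s ^ 2 - k ^ 2)) (hf0 : f 0 = 1) (hu0 : u 0 = 0) :
    0 ≤ ε * (f s₀ - Real.cosh (k * s₀)) := by
  rcases le_total 0 s₀ with hs | hs
  · rw [Set.uIcc_of_le hs] at hf hpos hu
    rw [Set.uIoo_of_le hs] at hu' h
    exact riccati_comparison_of_nonneg hs hf hpos hu hu' h hf0 hu0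
  · rw [Set.uIcc_of_ge hs] at hf hpos hu
    rw [Set.uIoo_of_ge hs] at hu' h
    have hI : ∀ s ∈ Set.Icc 0 (-s₀), -s ∈ Set.Icc s₀ 0 := fun s hs =>
      ⟨by linarith [hs.2], by linarith [hs.1]⟩
    have hI' : ∀ s ∈ Set.Ioo 0 (-s₀), -s ∈ Set.Ioo s₀ 0 := fun s hs =>
      ⟨by linarith [hs.2], by linarith [hs.1]⟩
    have := riccati_comparison_of_nonneg (k := k) (ε := ε) (s₀ := -s₀) (f := fun s => f (-s))
      (u := fun s => -u (-s)) (u' := fun s => u' (-s)) (by linarith)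
      (fun s hs => by
        have h1 := (hf _ (hI s hs)).comp s (hasDerivAt_neg s)
        exact h1.congr_deriv (by ring))
      (fun s hs => hpos _ (hI s hs))
      ((hu.comp continuousOn_neg hI).neg)
      (fun s hs => by
        have h1 := ((hu' _ (hI' s hs)).comp s (hasDerivAt_neg s)).neg
        exact h1.congr_deriv (by ring))
      (fun s hs => by simpa using h _ (hI' s hs)) (by simpa using hf0) (by simpa using hu0)
    simpa using this

/-! ### Partial derivatives -/

theorem hasDerivAt_snd_of_differentiableAt {f : ℝ × ℝ → ℝ} {t s : ℝ}
    (hf : DifferentiableAt ℝ f (t, s)) : HasDerivAt (fun r => f (t, r)) (pd 1 f (t, s)) s :=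
  hf.hasFDerivAt.comp_hasDerivAt s ((hasDerivAt_const s t).prodMk (hasDerivAt_id s))

theorem hasDerivAt_fst_of_differentiableAt {f : ℝ × ℝ → ℝ} {t s : ℝ}
    (hf : DifferentiableAt ℝ f (t, s)) : HasDerivAt (fun r => f (r, s)) (pd 0 f (t, s)) t :=
  hf.hasFDerivAt.comp_hasDerivAt t ((hasDerivAt_id t).prodMk (hasDerivAt_const t s))

theorem pd_congr {f g : ℝ × ℝ → ℝ} {p : ℝ × ℝ} (h : f =ᶠ[nhds p] g) (i : Fin 2) :
    pd i f p = pd i g p := by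
  rw [pd, pd, h.fderiv_eq]

theorem pd_const (i : Fin 2) (c : ℝ) (p : ℝ × ℝ) : pd i (fun _ => c) p = 0 := by
  simp [pd]

theorem metricInner_eq (G : ℝ × ℝ → Matrix (Fin 2) (Fin 2) ℝ) (p v w : ℝ × ℝ) :
    metricInner G p v w = G p 0 0 * v.1 * w.1 + G p 0 1 * v.1 * w.2 +
      (G p 1 0 * v.2 * w.1 + G p 1 1 * v.2 * w.2) := by
  simp [metricInner, coord, Fin.sum_univ_two]

namespace Cylinder

variable {l : ℝ} (C : Cylinder l)

/-! ### The metric tensor in Fermi coordinates -/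

theorem zero_mem_U : (0 : ℝ) ∈ C.U := C.mem_U 0 (by simpa using C.a_le) (by simpa using C.le_b)

theorem contDiffAt_metric (i j : Fin 2) {t s : ℝ} (hs : s ∈ C.U) :
    ContDiffAt ℝ ∞ (fun p => C.G p i j) (t, s) :=
  (C.smooth i j).contDiffAt ((isOpen_univ.prod C.isOpen_U).mem_nhds ⟨trivial, hs⟩)

theorem differentiableAt_metric (i j : Fin 2) {t s : ℝ} (hs : s ∈ C.U) :
    DifferentiableAt ℝ (fun p => C.G p i j) (t, s) :=
  (C.contDiffAt_metric i j hs).differentiableAt (by simp)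

theorem metric_symm {t s : ℝ} (hs : s ∈ C.U) : C.G (t, s) 1 0 = C.G (t, s) 0 1 := by
  simpa using (C.posDef t s hs).isHermitian.apply 0 1

theorem metric_zero_zero_pos {t s : ℝ} (hs : s ∈ C.U) : 0 < C.G (t, s) 0 0 :=
  (C.posDef t s hs).diag_pos

theorem deriv_vertical (t : ℝ) : deriv (fun s : ℝ => (t, s)) = fun _ => ((0 : ℝ), (1 : ℝ)) :=
  funext fun s => ((hasDerivAt_const s t).prodMk (hasDerivAt_id s)).deriv

theorem deriv_horizontal (r : ℝ) : deriv (fun t : ℝ => (t, r)) = fun _ => ((1 : ℝ), (0 : ℝ)) :=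
  funext fun s => ((hasDerivAt_id s).prodMk (hasDerivAt_const s r)).deriv

theorem metric_one_one {t s : ℝ} (ha : C.a ≤ s) (hb : (s : EReal) ≤ C.b) :
    C.G (t, s) 1 1 = 1 := by
  have h := (C.fiber t s ⟨ha, hb⟩).2.1
  rw [deriv_vertical, metricInner_eq] at h
  simpa using h

theorem christoffel_one_one {t s : ℝ} (ha : C.a ≤ s) (hb : (s : EReal) ≤ C.b) (m : Fin 2) :
    christoffel C.G m 1 1 (t, s) = 0 := by
  have h := (C.fiber t s ⟨ha, hb⟩).2.2 m
  rw [deriv_vertical] at h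
  fin_cases m <;> simpa [coord, Fin.sum_univ_two] using h

/-- The points of the open strip. -/
def strip : Set (ℝ × ℝ) := {p | C.a < (p.2 : EReal) ∧ (p.2 : EReal) < C.b}

theorem isOpen_strip : IsOpen C.strip := by
  have h : Continuous fun p : ℝ × ℝ => (p.2 : EReal) :=
    continuous_coe_real_ereal.comp continuous_snd
  exact (isOpen_lt continuous_const h).inter (isOpen_lt h continuous_const)

theorem mem_U_of_mem_strip {p : ℝ × ℝ} (hp : p ∈ C.strip) : p.2 ∈ C.U :=
  C.mem_U p.2 hp.1.le hp.2.le

theorem eventually_mem_strip {p : ℝ × ℝ} (hp : p ∈ C.strip) : ∀ᶠ q in nhds p, q ∈ C.strip :=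
  C.isOpen_strip.mem_nhds hp

/-- The infinitesimal Gauss lemma: since `G 1 1 = 1`, the Christoffel symbol `Γ⁰₁₁`, which vanishes
because the fibres are geodesics, equals `(G⁻¹) 0 0` times this derivative. -/
theorem pd_metric_zero_one {p : ℝ × ℝ} (hp : p ∈ C.strip) :
    pd 1 (fun q => C.G q 1 0) p = 0 := by
  obtain ⟨t, s⟩ := p
  have h11 : ∀ n, pd n (fun q => C.G q 1 1) (t, s) = 0 := fun n => by
    rw [pd_congr (g := fun _ => 1) ?_, pd_const]
    filter_upwards [C.eventually_mem_strip hp] with q hq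
    exact C.metric_one_one hq.1.le hq.2.le
  have h := C.christoffel_one_one (t := t) hp.1.le hp.2.le 0
  have hinv : (C.G (t, s))⁻¹ 0 0 ≠ 0 :=
    (C.posDef t s (C.mem_U_of_mem_strip hp)).inv.diag_pos.ne'
  simp only [christoffel, Fin.sum_univ_two, h11] at h
  have h2 : (C.G (t, s))⁻¹ 0 0 * pd 1 (fun q => C.G q 1 0) (t, s) = 0 := by linarith
  exact (mul_eq_zero.1 h2).resolve_left hinv

theorem mem_strip_of_mem_uIoo {t s r : ℝ} (ha : C.a ≤ s) (hb : (s : EReal) ≤ C.b)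
    (hr : r ∈ Set.uIoo 0 s) : (t, r) ∈ C.strip := by
  rcases le_total 0 s with h | h
  · rw [Set.uIoo_of_le h] at hr
    exact ⟨C.a_le.trans_lt (by exact_mod_cast hr.1), (EReal.coe_lt_coe_iff.2 hr.2).trans_le hb⟩
  · rw [Set.uIoo_of_ge h] at hr
    exact ⟨ha.trans_lt (EReal.coe_lt_coe_iff.2 hr.1),
      lt_of_lt_of_le (by exact_mod_cast hr.2) C.le_b⟩

theorem mem_U_of_mem_uIcc {s r : ℝ} (ha : C.a ≤ s) (hb : (s : EReal) ≤ C.b)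
    (hr : r ∈ Set.uIcc 0 s) : r ∈ C.U :=
  C.ordConnected_U.uIcc_subset C.zero_mem_U (C.mem_U s ha hb) hr

/-- The entry is constant along a fibre and vanishes on the baseline by perpendicularity. The mean
value theorem needs the derivative only inside the strip, so finite ends are included. -/
theorem metric_one_zero {t s : ℝ} (ha : C.a ≤ s) (hb : (s : EReal) ≤ C.b) :
    C.G (t, s) 1 0 = 0 := by
  have hd : ∀ r ∈ Set.uIcc 0 s, HasDerivAt (fun r => C.G (t, r) 1 0)
      (pd 1 (fun q => C.G q 1 0) (t, r)) r := fun r hr =>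
    hasDerivAt_snd_of_differentiableAt
      (C.differentiableAt_metric 1 0 (C.mem_U_of_mem_uIcc ha hb hr))
  have h0 : C.G (t, 0) 1 0 = 0 := by
    have := C.perpendicular t
    rw [metricInner_eq] at this
    rw [C.metric_symm C.zero_mem_U]
    simpa using this
  have hconst : C.G (t, s) 1 0 = C.G (t, 0) 1 0 := by
    rcases lt_trichotomy 0 s with h | h | h
    · rw [Set.uIcc_of_le h.le] at hd
      obtain ⟨c, hc, hcs⟩ := exists_hasDerivAt_eq_slope (fun r => C.G (t, r) 1 0)
        (fun r => pd 1 (fun q => C.G q 1 0) (t, r)) h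
        (fun r hr => (hd r hr).continuousAt.continuousWithinAt)
        (fun r hr => hd r (Set.Ioo_subset_Icc_self hr))
      rw [C.pd_metric_zero_one (C.mem_strip_of_mem_uIoo ha hb (by rwa [Set.uIoo_of_le h.le])),
        eq_comm, div_eq_zero_iff] at hcs
      rcases hcs with h' | h' <;> linarith
    · rw [← h]
    · rw [Set.uIcc_of_ge h.le] at hd
      obtain ⟨c, hc, hcs⟩ := exists_hasDerivAt_eq_slope (fun r => C.G (t, r) 1 0)
        (fun r => pd 1 (fun q => C.G q 1 0) (t, r)) h
        (fun r hr => (hd r hr).continuousAt.continuousWithinAt)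
        (fun r hr => hd r (Set.Ioo_subset_Icc_self hr))
      rw [C.pd_metric_zero_one (C.mem_strip_of_mem_uIoo ha hb (by rwa [Set.uIoo_of_ge h.le])),
        eq_comm, div_eq_zero_iff] at hcs
      rcases hcs with h' | h' <;> linarith
  rw [hconst, h0]

theorem metric_zero_one {t s : ℝ} (ha : C.a ≤ s) (hb : (s : EReal) ≤ C.b) :
    C.G (t, s) 0 1 = 0 := by
  rw [← C.metric_symm (C.mem_U s ha hb), C.metric_one_zero ha hb]

theorem metric_eq {t s : ℝ} (ha : C.a ≤ s) (hb : (s : EReal) ≤ C.b) :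
    C.G (t, s) = !![C.G (t, s) 0 0, 0; 0, 1] := by
  ext i j
  fin_cases i <;> fin_cases j <;>
    simp [C.metric_one_zero ha hb, C.metric_zero_one ha hb, C.metric_one_one ha hb]

theorem det_metric {t s : ℝ} (ha : C.a ≤ s) (hb : (s : EReal) ≤ C.b) :
    (C.G (t, s)).det = C.G (t, s) 0 0 := by
  rw [C.metric_eq ha hb]; simp

theorem inv_metric {t s : ℝ} (ha : C.a ≤ s) (hb : (s : EReal) ≤ C.b) :
    (C.G (t, s))⁻¹ = !![(C.G (t, s) 0 0)⁻¹, 0; 0, 1] := by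
  have hpos := C.metric_zero_zero_pos (t := t) (C.mem_U s ha hb)
  refine Matrix.inv_eq_right_inv ?_
  conv_lhs => rw [C.metric_eq ha hb]
  ext i j
  fin_cases i <;> fin_cases j <;> simp [Matrix.mul_apply, Fin.sum_univ_two, hpos.ne']

theorem metric_zero_zero_base (t : ℝ) : C.G (t, 0) 0 0 = 1 := by
  have h := (C.baseline t trivial).2.1
  rw [deriv_horizontal, metricInner_eq] at h
  simpa using h

/-- The baseline is a geodesic, so `Γ¹₀₀`, which is minus half this derivative, vanishes there. -/
theorem pd_metric_zero_zero_base (t : ℝ) : pd 1 (fun q => C.G q 0 0) (t, 0) = 0 := by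
  have ha : C.a ≤ ((0 : ℝ) : EReal) := by simpa using C.a_le
  have hb : ((0 : ℝ) : EReal) ≤ C.b := by simpa using C.le_b
  have h := (C.baseline t trivial).2.2 1
  rw [deriv_horizontal] at h
  have h1 : christoffel C.G 1 0 0 (t, 0) = 0 := by
    simpa [coord, Fin.sum_univ_two] using h
  have h01 : pd 0 (fun q => C.G q 0 1) (t, 0) = 0 := by
    have h2 := hasDerivAt_fst_of_differentiableAt
      (C.differentiableAt_metric 0 1 (t := t) C.zero_mem_U)
    have h3 : (fun r => C.G (r, 0) 0 1) = fun _ => 0 := funext fun r => C.metric_zero_one ha hb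
    rw [h3] at h2
    exact h2.unique (hasDerivAt_const t 0)
  simp only [christoffel, Fin.sum_univ_two, C.inv_metric ha hb, h01] at h1
  simpa using h1

/-! ### The Gaussian curvature in Fermi coordinates -/

/-- Half the logarithmic derivative of the coefficient `G 0 0` in the direction of the fibres. -/
def fiberSlope (p : ℝ × ℝ) : ℝ := pd 1 (fun q => C.G q 0 0) p / (2 * C.G p 0 0)

theorem differentiableAt_fiberSlope {t s : ℝ} (hs : s ∈ C.U) :
    DifferentiableAt ℝ C.fiberSlope (t, s) := by
  have h := C.contDiffAt_metric 0 0 (t := t) hs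
  have h1 : DifferentiableAt ℝ (fun p => pd 1 (fun q => C.G q 0 0) p) (t, s) := by
    have h2 : DifferentiableAt ℝ (fderiv ℝ (fun q => C.G q 0 0)) (t, s) :=
      (h.fderiv_right (m := 1) (by norm_cast)).differentiableAt (by simp)
    exact h2.clm_apply (differentiableAt_const _)
  have h2 : DifferentiableAt ℝ (fun p => 2 * C.G p 0 0) (t, s) :=
    (h.differentiableAt (by simp)).const_mul 2
  have h3 : C.fiberSlope = fun p => pd 1 (fun q => C.G q 0 0) p * (2 * C.G p 0 0)⁻¹ :=
    funext fun _ => div_eq_mul_inv _ _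
  rw [h3]
  exact h1.mul (h2.inv (mul_pos two_pos (C.metric_zero_zero_pos hs)).ne')

/-- In the diagonal metric the symbols `Γ⁰₀₁` and `Γ⁰₁₀` are the fibre slope and `Γᵐ₁₁ = 0`, so only
one derivative and one square survive in the curvature tensor. -/
theorem gaussCurvature_eq {t s : ℝ} (hp : (t, s) ∈ C.strip) :
    gaussCurvature C.G (t, s) = -pd 1 C.fiberSlope (t, s) - C.fiberSlope (t, s) ^ 2 := by
  have h01 : ∀ p ∈ C.strip, pd 0 (fun q => C.G q 0 1) p = 0 := fun p hp => by
    rw [pd_congr (g := fun _ => 0) ?_, pd_const]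
    filter_upwards [C.eventually_mem_strip hp] with q hq
    exact C.metric_zero_one hq.1.le hq.2.le
  have h10 : ∀ p ∈ C.strip, pd 0 (fun q => C.G q 1 0) p = 0 := fun p hp => by
    rw [pd_congr (g := fun _ => 0) ?_, pd_const]
    filter_upwards [C.eventually_mem_strip hp] with q hq
    exact C.metric_one_zero hq.1.le hq.2.le
  have hΓ01 : ∀ p ∈ C.strip, christoffel C.G 0 0 1 p = C.fiberSlope p := fun p hp => by
    simp only [christoffel, Fin.sum_univ_two, C.inv_metric (t := p.1) hp.1.le hp.2.le, h01 p hp,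
      h10 p hp, fiberSlope, Matrix.of_apply, Matrix.cons_val', Matrix.cons_val_zero,
      Matrix.cons_val_one, Matrix.cons_val_fin_one]
    field_simp
    ring
  have hΓ10 : ∀ p ∈ C.strip, christoffel C.G 0 1 0 p = C.fiberSlope p := fun p hp => by
    simp only [christoffel, Fin.sum_univ_two, C.inv_metric (t := p.1) hp.1.le hp.2.le,
      h10 p hp, fiberSlope, Matrix.of_apply, Matrix.cons_val', Matrix.cons_val_zero,
      Matrix.cons_val_one, Matrix.cons_val_fin_one]
    field_simp
    ring
  have hΓ11 : ∀ m, ∀ p ∈ C.strip, christoffel C.G m 1 1 p = 0 := fun m p hp =>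
    C.christoffel_one_one (t := p.1) hp.1.le hp.2.le m
  have hd0 : pd 0 (christoffel C.G 0 1 1) (t, s) = 0 := by
    rw [pd_congr (g := fun _ => 0) ?_, pd_const]
    filter_upwards [C.eventually_mem_strip hp] with q hq
    exact hΓ11 0 q hq
  have hd1 : pd 1 (christoffel C.G 0 0 1) (t, s) = pd 1 C.fiberSlope (t, s) := by
    refine pd_congr ?_ 1
    filter_upwards [C.eventually_mem_strip hp] with q hq
    exact hΓ01 q hq
  have hpos := C.metric_zero_zero_pos (t := t) (C.mem_U_of_mem_strip hp)
  rw [gaussCurvature, Fin.sum_univ_two, C.det_metric hp.1.le hp.2.le,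
    C.metric_zero_one hp.1.le hp.2.le, zero_mul, add_zero, mul_div_cancel_left₀ _ hpos.ne',
    riemannCoeff, Fin.sum_univ_two, hd0, hd1, hΓ11 0 _ hp, hΓ11 1 _ hp, hΓ01 _ hp, hΓ10 _ hp]
  ring

/-- For `f = √(G 0 0)` and `u` the fibre slope, `u' + u² - k²` is `-k²` minus the curvature. The
value `ε = 1` yields the lower bound on `f`, and `ε = -1` the upper bound needed in constant
curvature. -/
theorem lengthElement_comparison {k ε : ℝ} {t s : ℝ} (ha : C.a ≤ s) (hb : (s : EReal) ≤ C.b)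
    (hK : ∀ p ∈ C.strip, 0 ≤ ε * (-k ^ 2 - gaussCurvature C.G p)) :
    0 ≤ ε * (Real.sqrt (C.G (t, s) 0 0) - Real.cosh (k * s)) := by
  refine riccati_comparison (f := fun s => Real.sqrt (C.G (t, s) 0 0))
    (u := fun s => C.fiberSlope (t, s)) (u' := fun s => pd 1 C.fiberSlope (t, s))
    (fun r hr => ?_) (fun r hr => ?_) (fun r hr => ?_) (fun r hr => ?_) (fun r hr => ?_) ?_ ?_
  · have hU := C.mem_U_of_mem_uIcc ha hb hr
    have hpos := C.metric_zero_zero_pos (t := t) hU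
    have h := (hasDerivAt_snd_of_differentiableAt
      (C.differentiableAt_metric 0 0 (t := t) hU)).sqrt hpos.ne'
    refine h.congr_deriv ?_
    rw [fiberSlope]
    have h2 := Real.mul_self_sqrt hpos.le
    have h3 := Real.sqrt_pos.2 hpos
    field_simp
    rw [sq, h2]
  · exact Real.sqrt_pos.2 (C.metric_zero_zero_pos (C.mem_U_of_mem_uIcc ha hb hr))
  · exact (hasDerivAt_snd_of_differentiableAt (C.differentiableAt_fiberSlope
      (C.mem_U_of_mem_uIcc ha hb hr))).continuousAt.continuousWithinAt
  · exact hasDerivAt_snd_of_differentiableAt (C.differentiableAt_fiberSlope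
      (C.mem_U_of_mem_strip (p := (t, r)) (C.mem_strip_of_mem_uIoo ha hb hr)))
  · have hm := C.mem_strip_of_mem_uIoo (t := t) ha hb hr
    have := hK _ hm
    rw [C.gaussCurvature_eq hm] at this
    convert this using 2
    ring
  · simp [C.metric_zero_zero_base]
  · simp [fiberSlope, C.pd_metric_zero_zero_base]

end Cylinder
end

noncomputable section

/-! ### Winding numbers of loops in the punctured complex plane -/

/-- The curve `γ`, restricted to `[0, 1]`, has the winding number `n` about the origin. -/
def HasWinding (γ : ℝ → ℂ) (n : ℤ) : Prop :=
  ∃ h : ℝ → ℂ, Continuous h ∧ (∀ u, Complex.exp (h u) = γ u) ∧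
    h 1 - h 0 = n * (2 * Real.pi * Complex.I)

theorem eq_of_exp_comp_eq {X : Type*} [TopologicalSpace X] [PreconnectedSpace X] {f g : X → ℂ}
    (hf : Continuous f) (hg : Continuous g) (h : ∀ x, Complex.exp (f x) = Complex.exp (g x))
    (x₀ : X) (h₀ : f x₀ = g x₀) : f = g :=
  Complex.isCoveringMap_exp.eq_of_comp_eq hf hg
    (funext fun x => Subtype.ext (h x)) x₀ h₀

theorem HasWinding.unique {γ : ℝ → ℂ} {m n : ℤ} (hm : HasWinding γ m) (hn : HasWinding γ n) :
    m = n := by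
  obtain ⟨f, hf, hfγ, hf1⟩ := hm
  obtain ⟨g, hg, hgγ, hg1⟩ := hn
  have key : f = fun u => g u + (f 0 - g 0) := by
    refine eq_of_exp_comp_eq hf (by fun_prop) (fun u => ?_) 0 (by ring)
    rw [Complex.exp_add, Complex.exp_sub, hfγ, hfγ, hgγ, hgγ, div_self, mul_one]
    rw [← hfγ]; exact Complex.exp_ne_zero _
  have h1 := congrFun key 1
  have h2 : (m : ℂ) * (2 * Real.pi * Complex.I) = n * (2 * Real.pi * Complex.I) := by
    rw [← hf1, ← hg1, h1]; ring
  exact_mod_cast mul_right_cancel₀ Complex.two_pi_I_ne_zero h2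

theorem HasWinding.mul {γ δ : ℝ → ℂ} {m n : ℤ} (hm : HasWinding γ m) (hn : HasWinding δ n) :
    HasWinding (fun u => γ u * δ u) (m + n) := by
  obtain ⟨f, hf, hfγ, hf1⟩ := hm
  obtain ⟨g, hg, hgγ, hg1⟩ := hn
  refine ⟨fun u => f u + g u, by fun_prop, fun u => by rw [Complex.exp_add, hfγ, hgγ], ?_⟩
  push_cast
  linear_combination hf1 + hg1

theorem hasWinding_zero_of_mem_slitPlane {γ : ℝ → ℂ} (hγ : Continuous γ)
    (hs : ∀ u, γ u ∈ Complex.slitPlane) (h01 : γ 1 = γ 0) : HasWinding γ 0 :=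
  ⟨fun u => Complex.log (γ u), hγ.clog hs,
    fun u => Complex.exp_log (Complex.slitPlane_ne_zero (hs u)), by simp [h01]⟩

theorem hasWinding_const {z : ℂ} (hz : z ≠ 0) : HasWinding (fun _ => z) 0 :=
  ⟨fun _ => Complex.log z, continuous_const, fun _ => Complex.exp_log hz, by simp⟩

theorem hasWinding_exp :
    HasWinding (fun u : ℝ => Complex.exp (u * (2 * Real.pi * Complex.I))) 1 :=
  ⟨fun u => u * (2 * Real.pi * Complex.I), by fun_prop, fun _ => rfl, by simp⟩

/-- The homotopy lifts through `exp`, and the increment of the lift over `[0, 1]` does not depend on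
the homotopy parameter, by uniqueness of lifts, because every curve closes up. -/
theorem HasWinding.of_homotopy {H : unitInterval → ℝ → ℂ} {n : ℤ}
    (hH : Continuous fun x : unitInterval × ℝ => H x.1 x.2) (h0 : ∀ σ u, H σ u ≠ 0)
    (hloop : ∀ σ, H σ 1 = H σ 0) (hn : HasWinding (H 0) n) : HasWinding (H 1) n := by
  -- Extending the parameter to all of `ℝ` makes the domain the simply connected plane, where a lift
  -- exists.
  let r : ℝ → unitInterval := Set.projIcc 0 1 zero_le_one
  have hr : Continuous r := continuous_projIcc
  let Hc : C(ℝ × ℝ, {z : ℂ // z ≠ 0}) :=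
    ⟨fun x => ⟨H (r x.1) x.2, h0 _ _⟩,
      (hH.comp ((hr.comp continuous_fst).prodMk continuous_snd)).subtype_mk _⟩
  have hbase : (⟨_, (Complex.log (H (r 0) 0)).exp_ne_zero⟩ : {z : ℂ // z ≠ 0}) = Hc (0, 0) :=
    Subtype.ext (Complex.exp_log (h0 (r 0) 0))
  obtain ⟨h', ⟨-, hh⟩, -⟩ :=
    Complex.isCoveringMap_exp.existsUnique_continuousMap_lifts Hc (0, 0) _ hbase
  let h : unitInterval × ℝ → ℂ := fun x => h' (x.1, x.2)
  have hcont : Continuous h := by fun_prop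
  have hexp : ∀ σ u, Complex.exp (h (σ, u)) = H σ u := fun σ u => by
    have := congrArg Subtype.val (congrFun hh ((σ : ℝ), u))
    simpa [Hc, r] using this
  have hconst : (fun σ : unitInterval => h (σ, 1)) = fun σ => h (σ, 0) + (h (0, 1) - h (0, 0)) := by
    refine eq_of_exp_comp_eq (by fun_prop) (by fun_prop) (fun σ => ?_) 0 (by ring)
    rw [Complex.exp_add, Complex.exp_sub, hexp, hexp, hexp, hexp, hloop, hloop, div_self (h0 _ _),
      mul_one]
  obtain ⟨g, hg, hgγ, hg1⟩ := hn
  have h0n : h (0, 1) - h (0, 0) = n * (2 * Real.pi * Complex.I) := by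
    have key : g = fun u => h (0, u) + (g 0 - h (0, 0)) := by
      refine eq_of_exp_comp_eq hg (by fun_prop) (fun u => ?_) 0 (by ring)
      rw [Complex.exp_add, Complex.exp_sub, hexp, hexp, hgγ, hgγ, div_self (h0 _ _), mul_one]
    rw [← hg1, congrFun key 1]; ring
  refine ⟨fun u => h (1, u), by fun_prop, fun u => hexp 1 u, ?_⟩
  have h1 : h (1, 1) = h (1, 0) + (h (0, 1) - h (0, 0)) := congrFun hconst 1
  change h (1, 1) - h (1, 0) = _
  linear_combination h1 + h0n
end

noncomputable section

/-! ### Isotopies of the cylinder -/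

theorem circle_eq_one_of_mul_pos {e : Circle} {w : ℝ} (hw : 0 < w) (him : ((e : ℂ) * w).im = 0)
    (hre : 0 < ((e : ℂ) * w).re) : e = 1 := by
  have h1 : (e : ℂ).im = 0 := by
    simpa [hw.ne'] using him
  have h2 : 0 < (e : ℂ).re := by
    simpa [hw] using hre
  have h3 : (e : ℂ).re * (e : ℂ).re + (e : ℂ).im * (e : ℂ).im = 1 := by
    rw [← Complex.normSq_apply]; exact Circle.normSq_coe e
  have h4 : (e : ℂ).re = 1 := by nlinarith
  exact Subtype.ext (Complex.ext (by simpa using h4) (by simpa using h1))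

/-- A family of loops `θ` of winding number one about a circle, and functions `f` on these
loops, which are below `τ` on the fibre of `t` in the first loop, and above `τ` on the fibre of
`t` in the last loop, attain the value `τ` on the fibre of `t`. -/
theorem exists_eq_on_fiber {θ : unitInterval → ℝ → Circle}
    {f : unitInterval → ℝ → ℝ} (hθ : Continuous fun x : unitInterval × ℝ => θ x.1 x.2)
    (hf : Continuous fun x : unitInterval × ℝ => f x.1 x.2)
    (hθl : ∀ σ, θ σ 1 = θ σ 0) (hfl : ∀ σ, f σ 1 = f σ 0)
    (hw : HasWinding (fun u => (θ 1 u : ℂ)) 1) (t : Circle) (τ : ℝ)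
    (h0 : ∀ u, θ 0 u = t → f 0 u < τ) (h1 : ∀ u, θ 1 u = t → τ < f 1 u) :
    ∃ σ u, θ σ u = t ∧ f σ u = τ := by
  by_contra! hne
  have hf1 : Continuous fun u => f 1 u := hf.comp (Continuous.prodMk_right 1)
  -- Polar coordinates send the point `(t, τ)` to `1`, so the claim is that some loop `z σ` passes
  -- through `1`. Otherwise `z - 1` has the same winding number for `σ = 0` and `σ = 1`.
  let z : unitInterval → ℝ → ℂ := fun σ u =>
    ((θ σ u / t : Circle) : ℂ) * (Real.exp (f σ u - τ) : ℝ)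
  have hz : Continuous fun x : unitInterval × ℝ => z x.1 x.2 := by
    have hd : Continuous fun x : unitInterval × ℝ => θ x.1 x.2 / t := hθ.div_const t
    simp only [z]
    fun_prop
  have hzpos : ∀ σ u, (z σ u).im = 0 → 0 < (z σ u).re →
      θ σ u = t ∧ z σ u = (Real.exp (f σ u - τ) : ℝ) := by
    intro σ u him hre
    have h := circle_eq_one_of_mul_pos (Real.exp_pos _) him hre
    exact ⟨div_eq_one.1 h, by simp only [z, h, Circle.coe_one, one_mul]⟩
  have hz0 : ∀ σ u, z σ u ≠ 0 := fun σ u =>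
    mul_ne_zero (Circle.coe_ne_zero _) (Complex.ofReal_ne_zero.2 (Real.exp_pos _).ne')
  have hloop : ∀ σ, z σ 1 = z σ 0 := fun σ => by simp [z, hθl, hfl]
  have hH : Continuous fun x : unitInterval × ℝ => z x.1 x.2 - 1 := by fun_prop
  have hHne : ∀ σ u, z σ u - 1 ≠ 0 := by
    intro σ u h
    have hz1 : z σ u = 1 := sub_eq_zero.1 h
    obtain ⟨ht, he⟩ := hzpos σ u (by simp [hz1]) (by simp [hz1])
    refine hne σ u ht ?_
    rw [hz1] at he
    have : Real.exp (f σ u - τ) = 1 := by exact_mod_cast he.symm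
    linarith [Real.exp_eq_one_iff _ |>.1 this]
  -- When `z 0` is a positive real number it is less than `1`, so `1 - z 0` stays in the slit plane.
  have hfirst : HasWinding (fun u => z 0 u - 1) 0 := by
    have hs : HasWinding (fun u => 1 - z 0 u) 0 := by
      refine hasWinding_zero_of_mem_slitPlane ?_ ?_ (by simp [hloop])
      · exact continuous_const.sub (hz.comp (Continuous.prodMk_right 0))
      · intro u
        by_contra hns
        rw [Complex.mem_slitPlane_iff, not_or, not_lt, not_not] at hns
        have hr : 1 ≤ (z 0 u).re := by simpa using hns.1
        obtain ⟨ht, he⟩ := hzpos 0 u (by simpa using hns.2) (by linarith)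
        rw [he, Complex.ofReal_re] at hr
        linarith [h0 u ht, Real.one_le_exp_iff.1 hr]
    have := (hasWinding_const (neg_ne_zero.2 (one_ne_zero (α := ℂ)))).mul hs
    simpa using this
  -- Here `z - 1 = z (1 - 1/z)`. The factor `z` winds once with `θ 1`, and `1 - 1/z` stays in the
  -- slit plane because `z > 1` whenever `z` is a positive real number.
  have hlast : HasWinding (fun u => z 1 u - 1) 1 := by
    have hzc1 : Continuous fun u => z 1 u := hz.comp (Continuous.prodMk_right 1)
    have hs : HasWinding (fun u => 1 - (z 1 u)⁻¹) 0 := by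
      refine hasWinding_zero_of_mem_slitPlane ?_ ?_ (by simp [hloop])
      · exact continuous_const.sub (hzc1.inv₀ (hz0 1))
      · intro u
        by_contra hns
        rw [Complex.mem_slitPlane_iff, not_or, not_lt, not_not] at hns
        have hinv : (z 1 u)⁻¹ =
            (((θ 1 u / t)⁻¹ : Circle) : ℂ) * ((Real.exp (f 1 u - τ))⁻¹ : ℝ) := by
          simp only [z, mul_inv, Circle.coe_inv, Complex.ofReal_inv]
        have hr : 1 ≤ ((z 1 u)⁻¹).re := by
          have := hns.1
          rw [Complex.sub_re, Complex.one_re] at this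
          linarith
        have hi : ((z 1 u)⁻¹).im = 0 := by
          have := hns.2
          rw [Complex.sub_im, Complex.one_im] at this
          linarith
        have h := circle_eq_one_of_mul_pos (inv_pos.2 (Real.exp_pos (f 1 u - τ)))
          (hinv ▸ hi) (hinv ▸ (by linarith : 0 < ((z 1 u)⁻¹).re))
        have ht : θ 1 u = t := div_eq_one.1 (inv_eq_one.1 h)
        rw [hinv, h, Circle.coe_one, one_mul, Complex.ofReal_re, ← Real.exp_neg,
          Real.one_le_exp_iff] at hr
        linarith [h1 u ht]
    have hexp : HasWinding (fun u => (((Real.exp (f 1 u - τ) : ℝ) : ℂ) / t)) 0 := by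
      have h1 : HasWinding (fun u => (((Real.exp (f 1 u - τ) : ℝ) : ℂ))) 0 :=
        hasWinding_zero_of_mem_slitPlane (by fun_prop)
          (fun u => Or.inl (Real.exp_pos _)) (by simp [hfl])
      have h2 := h1.mul (hasWinding_const (inv_ne_zero (Circle.coe_ne_zero t)))
      simpa [div_eq_mul_inv] using h2
    have := (hw.mul hexp).mul hs
    rw [add_zero, add_zero] at this
    convert this using 2 with u
    have hne := hz0 1 u
    rw [mul_sub, show (θ 1 u : ℂ) * (((Real.exp (f 1 u - τ) : ℝ) : ℂ) / t) = z 1 u by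
      simp only [z, Circle.coe_div]; ring, mul_one, mul_inv_cancel₀ hne]
  have := HasWinding.of_homotopy hH hHne (fun σ => by rw [hloop]) hfirst
  exact absurd (this.unique hlast) (by norm_num)

/-! ### The cylinder as the punctured plane, and invariance of domain -/

variable {l : ℝ}

/-- The embedding of the cylinder as the punctured complex plane. -/
def toPlane (p : AddCircle l × ℝ) : ℂ := (AddCircle.toCircle p.1 : ℂ) * (Real.exp p.2 : ℝ)

theorem continuous_toPlane : Continuous (toPlane (l := l)) := by
  have h : Continuous fun p : AddCircle l × ℝ => AddCircle.toCircle p.1 :=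
    AddCircle.continuous_toCircle.comp continuous_fst
  unfold toPlane
  fun_prop

theorem injective_toPlane (hl : 0 < l) : Function.Injective (toPlane (l := l)) := by
  rintro ⟨x, s⟩ ⟨y, r⟩ h
  have hs : s = r := by
    have := congrArg norm h
    simpa only [toPlane, norm_mul, Circle.norm_coe, one_mul, Complex.norm_real,
      Real.norm_eq_abs, Real.abs_exp, Real.exp_eq_exp] using this
  subst hs
  have hc : (AddCircle.toCircle x : ℂ) = AddCircle.toCircle y :=
    mul_right_cancel₀ (Complex.ofReal_ne_zero.2 (Real.exp_pos s).ne') h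
  rw [AddCircle.injective_toCircle hl.ne' (Subtype.ext hc)]

/-- A chart of the cylinder around `(t, s)`, in which `toPlane` is the exponential map. -/
def cylChart (t s : ℝ) (ζ : ℂ) : AddCircle l × ℝ :=
  (((t + l / (2 * Real.pi) * ζ.im : ℝ) : AddCircle l), s + ζ.re)

theorem continuous_cylChart (t s : ℝ) : Continuous (cylChart (l := l) t s) := by
  unfold cylChart
  exact ((AddCircle.continuous_mk' l).comp (by fun_prop)).prodMk (by fun_prop)

theorem toPlane_cylChart (hl : 0 < l) (t s : ℝ) (ζ : ℂ) :
    toPlane (cylChart (l := l) t s ζ) = toPlane ((t : AddCircle l), s) * Complex.exp ζ := by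
  have hpi := Real.pi_ne_zero
  have e1 : (2 * Real.pi / l * (t + l / (2 * Real.pi) * ζ.im) : ℝ) =
      2 * Real.pi / l * t + ζ.im := by
    field_simp
  have e2 : Complex.exp ζ = Complex.exp ζ.re * Complex.exp (ζ.im * Complex.I) := by
    rw [← Complex.exp_add, Complex.re_add_im]
  simp only [toPlane, cylChart, AddCircle.toCircle_apply_mk, e1, Circle.exp_add, Circle.coe_mul,
    Circle.coe_exp, Complex.ofReal_exp]
  rw [e2, Complex.ofReal_add, Complex.exp_add]
  ring

/-- The factor `(exp ζ - 1) / ζ` differs from `1` by at most `|ζ| = r < 1`, so all the winding comes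
from `ζ`. -/
theorem hasWinding_exp_circle_sub_one {r : ℝ} (hr0 : 0 < r) (hr1 : r < 1) :
    HasWinding (fun u : ℝ => Complex.exp (r * Complex.exp (u * (2 * Real.pi * Complex.I))) - 1)
      1 := by
  let ζ : ℝ → ℂ := fun u => r * Complex.exp (u * (2 * Real.pi * Complex.I))
  have hζ : Continuous ζ := by fun_prop
  have hnorm : ∀ u, ‖ζ u‖ = r := by
    intro u
    have : (u : ℂ) * (2 * Real.pi * Complex.I) = (u * (2 * Real.pi) : ℝ) * Complex.I := by
      push_cast; ring
    simp only [ζ, norm_mul, this, Complex.norm_exp_ofReal_mul_I, Complex.norm_real, mul_one]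
    exact abs_of_pos hr0
  have hζ0 : ∀ u, ζ u ≠ 0 := fun u => norm_ne_zero_iff.1 (by rw [hnorm]; exact hr0.ne')
  have hper : ζ 1 = ζ 0 := by simp [ζ]
  have hw1 : HasWinding ζ 1 := by
    simpa using (hasWinding_const (Complex.ofReal_ne_zero.2 hr0.ne')).mul hasWinding_exp
  have hw2 : HasWinding (fun u => (Complex.exp (ζ u) - 1) / ζ u) 0 := by
    refine hasWinding_zero_of_mem_slitPlane ?_ (fun u => ?_) (by simp [hper])
    · exact (by fun_prop : Continuous fun u => Complex.exp (ζ u) - 1).div hζ hζ0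
    · have h := Complex.norm_exp_sub_one_sub_id_le (x := ζ u) (by rw [hnorm]; exact hr1.le)
      rw [hnorm] at h
      have hlt : ‖(Complex.exp (ζ u) - 1) / ζ u - 1‖ < 1 := by
        rw [div_sub_one (hζ0 u), norm_div, hnorm, div_lt_one hr0]
        nlinarith
      simpa using Complex.mem_slitPlane_of_norm_lt_one hlt
  have := hw1.mul hw2
  rw [add_zero] at this
  convert this using 2 with u
  change Complex.exp (ζ u) - 1 = _
  rw [mul_div_cancel₀ _ (hζ0 u)]

/-- The end of an isotopy of the inclusion of an open subset of the cylinder has an open image. -/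
theorem isOpen_range_of_isotopy (hl : 0 < l) {W : Set (AddCircle l × ℝ)} (hW : IsOpen W)
    {J : unitInterval → W → AddCircle l × ℝ}
    (hJ : Continuous fun x : unitInterval × W => J x.1 x.2)
    (hinj : ∀ τ, Function.Injective (J τ)) (h0 : ∀ x : W, J 0 x = x) :
    IsOpen (Set.range (J 1)) := by
  rw [isOpen_iff_mem_nhds]
  rintro _ ⟨⟨⟨x, s⟩, hx⟩, rfl⟩
  obtain ⟨t, rfl⟩ := QuotientAddGroup.mk_surjective x
  obtain ⟨r, hr0, hr1, hr⟩ : ∃ r : ℝ, 0 < r ∧ r < 1 ∧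
      ∀ ζ : ℂ, ‖ζ‖ ≤ r → cylChart (l := l) t s ζ ∈ W := by
    have hmem : cylChart (l := l) t s ⁻¹' W ∈ nhds (0 : ℂ) := by
      refine (continuous_cylChart t s).continuousAt.preimage_mem_nhds (hW.mem_nhds ?_)
      simpa [cylChart] using hx
    obtain ⟨ε, hε, hεW⟩ := Metric.mem_nhds_iff.1 hmem
    refine ⟨min (ε / 2) (1 / 2), by positivity, by norm_num, fun ζ hζ => hεW ?_⟩
    rw [mem_ball_zero_iff]
    have := hζ.trans (min_le_left _ _)
    linarith
  let x₀ : W := ⟨((t : AddCircle l), s), hx⟩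
  let ζ : unitInterval → ℝ → ℂ := fun σ u =>
    σ * (r * Complex.exp (u * (2 * Real.pi * Complex.I)))
  have hζ : Continuous fun x : unitInterval × ℝ => ζ x.1 x.2 := by fun_prop
  have hnorm : ∀ σ u, ‖ζ σ u‖ = σ * r := by
    intro σ u
    have : (u : ℂ) * (2 * Real.pi * Complex.I) = (u * (2 * Real.pi) : ℝ) * Complex.I := by
      push_cast; ring
    simp only [ζ, norm_mul, this, Complex.norm_exp_ofReal_mul_I, Complex.norm_real, mul_one,
      Real.norm_eq_abs, abs_of_pos hr0, abs_of_nonneg σ.2.1]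
  have hζr : ∀ σ u, ‖ζ σ u‖ ≤ r := fun σ u => by
    rw [hnorm]; exact mul_le_of_le_one_left hr0.le σ.2.2
  let c : unitInterval → ℝ → W := fun σ u => ⟨cylChart t s (ζ σ u), hr _ (hζr σ u)⟩
  have hc : Continuous fun x : unitInterval × ℝ => c x.1 x.2 :=
    ((continuous_cylChart t s).comp hζ).subtype_mk _
  have hc1 : Continuous fun u => c 1 u := hc.comp (Continuous.prodMk_right 1)
  have hcloop : ∀ σ, c σ 1 = c σ 0 := fun σ => by simp [c, ζ]
  have hJ1 : Continuous (J 1) := hJ.comp (Continuous.prodMk_right 1)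
  have hEx₀ : toPlane (x₀ : AddCircle l × ℝ) ≠ 0 :=
    mul_ne_zero (Circle.coe_ne_zero _) (Complex.ofReal_ne_zero.2 (Real.exp_pos _).ne')
  have hne : ∀ ξ : ℂ, ‖ξ‖ = r → cylChart (l := l) t s ξ ≠ ((t : AddCircle l), s) := by
    intro ξ hξ h
    have h1 := toPlane_cylChart hl t s ξ
    rw [h] at h1
    have h2 : Complex.exp ξ = 1 := mul_left_cancel₀ hEx₀ (by rw [mul_one]; exact h1.symm)
    have h3 := Complex.norm_exp_sub_one_sub_id_le (x := ξ) (by rw [hξ]; exact hr1.le)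
    rw [h2, sub_self, zero_sub, norm_neg, hξ] at h3
    nlinarith
  -- The winding number of a small circle about its centre is transported along the isotopy;
  -- injectivity of each `J τ` keeps the image of the circle off the image of the centre.
  have hstart : HasWinding (fun u => toPlane (J 1 (c 1 u)) - toPlane (J 1 x₀)) 1 := by
    refine HasWinding.of_homotopy
      (H := fun τ u => toPlane (J τ (c 1 u)) - toPlane (J τ x₀)) ?_ ?_ ?_ ?_
    · exact (continuous_toPlane.comp
        (hJ.comp (continuous_fst.prodMk (hc1.comp continuous_snd)))).sub
        (continuous_toPlane.comp (hJ.comp (continuous_fst.prodMk continuous_const)))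
    · intro τ u h
      have := hinj τ (injective_toPlane hl (sub_eq_zero.1 h))
      exact hne (ζ 1 u) (by simp [hnorm]) (congrArg Subtype.val this)
    · intro τ
      simp only [hcloop]
    · have := (hasWinding_const hEx₀).mul (hasWinding_exp_circle_sub_one hr0 hr1)
      rw [zero_add] at this
      convert this using 2 with u
      rw [h0, h0, toPlane_cylChart hl]
      simp only [ζ, x₀, Set.Icc.coe_one, Complex.ofReal_one, one_mul]
      ring
  let K : Set ℂ := Set.range fun ξ : Metric.sphere (0 : ℂ) r =>
    toPlane (J 1 ⟨cylChart t s ξ, hr ξ (by simp)⟩)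
  have hK : IsCompact K := by
    refine isCompact_range (continuous_toPlane.comp (hJ1.comp ?_))
    exact ((continuous_cylChart t s).comp continuous_subtype_val).subtype_mk _
  have hcK : ∀ u, toPlane (J 1 (c 1 u)) ∈ K := fun u => ⟨⟨ζ 1 u, by simp [hnorm]⟩, rfl⟩
  have hyK : toPlane (J 1 x₀) ∈ Kᶜ := by
    rintro ⟨ξ, hξ⟩
    have := hinj 1 (injective_toPlane hl hξ)
    exact hne ξ (by simp) (congrArg Subtype.val this)
  obtain ⟨ε, hε, hεK⟩ := Metric.isOpen_iff.1 hK.isClosed.isOpen_compl _ hyK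
  have hnhds : toPlane ⁻¹' Metric.ball (toPlane (J 1 x₀)) ε ∈ nhds (J 1 x₀) :=
    continuous_toPlane.continuousAt.preimage_mem_nhds (Metric.ball_mem_nhds _ hε)
  refine Filter.mem_of_superset hnhds fun y hy => ?_
  by_contra hyr
  -- Moving the centre to `y` along a segment keeps it in a ball disjoint from the image of the
  -- circle.
  have hone : HasWinding (fun u => toPlane (J 1 (c 1 u)) - toPlane y) 1 := by
    have := HasWinding.of_homotopy (n := 1) (H := fun σ u => toPlane (J 1 (c 1 u)) -
      AffineMap.lineMap (toPlane (J 1 x₀)) (toPlane y) (σ : ℝ)) ?_ ?_ ?_ ?_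
    · simpa using this
    · exact (continuous_toPlane.comp (hJ1.comp (hc1.comp continuous_snd))).sub
        (AffineMap.lineMap_continuous.comp (continuous_subtype_val.comp continuous_fst))
    · intro σ u h
      have hball := (convex_ball (toPlane (J 1 x₀)) ε).lineMap_mem (Metric.mem_ball_self hε) hy σ.2
      exact hεK hball (sub_eq_zero.1 h ▸ hcK u)
    · intro σ
      simp only [hcloop]
    · simpa using hstart
  -- If `y` is not in the image, shrinking the circle to its centre never meets `y`, so the winding
  -- number is also `0`.
  have hzero : HasWinding (fun u => toPlane (J 1 (c 1 u)) - toPlane y) 0 := by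
    refine HasWinding.of_homotopy (H := fun σ u => toPlane (J 1 (c σ u)) - toPlane y) ?_ ?_ ?_ ?_
    · exact (continuous_toPlane.comp (hJ1.comp hc)).sub continuous_const
    · intro σ u h
      exact hyr ⟨_, injective_toPlane hl (sub_eq_zero.1 h)⟩
    · intro σ
      simp only [hcloop]
    · have hc0 : ∀ u, c 0 u = c 0 0 := fun u => by simp [c, ζ]
      simp only [hc0]
      refine hasWinding_const fun h => ?_
      exact hyr ⟨_, injective_toPlane hl (sub_eq_zero.1 h)⟩
  exact absurd (hone.unique hzero) one_ne_zero
end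

noncomputable section

/-! ### The ends of an annulus on a vertical line -/

section Ends

variable {l : ℝ} {X : Type*} [TopologicalSpace X] {j : X → AddCircle l × ℝ} {lev : X → ℝ}
  {a b : EReal}

/-- The limit points of `j x` as `lev x` tends to `a`. -/
def lowerEnd (j : X → AddCircle l × ℝ) (lev : X → ℝ) (a b : EReal) : Set (AddCircle l × ℝ) :=
  ⋂ c ∈ {c : ℝ | a < (c : EReal) ∧ (c : EReal) < b}, closure (j '' {x | lev x < c})

/-- The piece between the levels `c` and `c₀` has compact, hence closed, image, so it cannot
contribute limit points outside the range of `j`. -/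
theorem mem_lowerEnd_of_mem_closure (hj : Continuous j)
    (hcpt : ∀ c d : ℝ, a < c → (d : EReal) < b → IsCompact {x | c ≤ lev x ∧ lev x ≤ d})
    {c₀ : ℝ} (hc₀ : (c₀ : EReal) < b) {y : AddCircle l × ℝ}
    (hy : y ∈ closure (j '' {x | lev x < c₀})) (hyr : y ∉ Set.range j) :
    y ∈ lowerEnd j lev a b := by
  refine Set.mem_iInter₂.2 fun c hc => ?_
  have hK : IsClosed (j '' {x | c ≤ lev x ∧ lev x ≤ c₀}) :=
    ((hcpt c c₀ hc.1 hc₀).image hj).isClosed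
  have hsub : j '' {x | lev x < c₀} ⊆
      j '' {x | lev x < c} ∪ j '' {x | c ≤ lev x ∧ lev x ≤ c₀} := by
    rw [← Set.image_union]
    refine Set.image_mono fun x (hx : lev x < c₀) => ?_
    rcases lt_or_ge (lev x) c with h | h
    · exact Or.inl h
    · exact Or.inr ⟨h, hx.le⟩
  have h := closure_mono hsub hy
  rw [closure_union, hK.closure_eq] at h
  exact h.resolve_right fun h' => hyr (Set.image_subset_range _ _ h')

/-- Finite length forces gaps: far out on the line, every point of the slice has a point outside the
slice within distance `ε`. The first such point above belongs to the lower end, where `F = 0`, so `F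
≤ L ε < τ` at the original point. -/
theorem exists_abs_le_of_volume_lt_top (hj : Topology.IsOpenEmbedding j) (hlev : Continuous lev)
    (hcpt : ∀ c d : ℝ, a < c → (d : EReal) < b → IsCompact {x | c ≤ lev x ∧ lev x ≤ d})
    {t : AddCircle l} (hvol : MeasureTheory.volume {σ : ℝ | (t, σ) ∈ Set.range j} ≠ ⊤)
    {F : AddCircle l × ℝ → ℝ} {L : ℝ≥0}
    (hF : ∀ σ σ' : ℝ, (t, σ) ∈ closure (Set.range j) → (t, σ') ∈ closure (Set.range j) →
      |F (t, σ) - F (t, σ')| ≤ L * |σ - σ'|)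
    (hB : ∀ x ∈ lowerEnd j lev a b, F x = 0) {τ : ℝ} (hτ : 0 < τ)
    {c₀ : ℝ} (hac₀ : a < c₀) (hc₀ : (c₀ : EReal) < b) :
    ∃ R : ℝ, ∀ x σ, lev x < c₀ → j x = (t, σ) → τ ≤ F (t, σ) → |σ| ≤ R := by
  let At : Set ℝ := {σ : ℝ | (t, σ) ∈ Set.range j}
  have hAt : IsOpen At := hj.isOpen_range.preimage (Continuous.prodMk_right t)
  obtain ⟨ε, hε, hLε⟩ : ∃ ε : ℝ, 0 < ε ∧ L * ε < τ := by
    refine ⟨τ / (L + 1), by positivity, ?_⟩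
    rw [← mul_div_assoc, div_lt_iff₀ (by positivity)]
    nlinarith
  obtain ⟨K, hKA, hK, hKε⟩ := hAt.measurableSet.exists_isCompact_sdiff_lt
    (μ := MeasureTheory.volume) hvol (ε := ENNReal.ofReal ε) (by simpa using hε)
  obtain ⟨R₁, hR₁⟩ := hK.isBounded.exists_norm_le
  have hlevel : IsCompact (j '' {x | c₀ ≤ lev x ∧ lev x ≤ c₀}) :=
    (hcpt c₀ c₀ hac₀ hc₀).image hj.continuous
  obtain ⟨R₂, hR₂⟩ := (hlevel.image continuous_snd).isBounded.exists_norm_le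
  refine ⟨max R₁ R₂ + ε, fun x σ hx hjx hFσ => ?_⟩
  by_contra! hσ
  have hfar : ∀ q ∈ Set.Icc σ (σ + ε), max R₁ R₂ < |q| := by
    intro q hq
    have h1 := abs_sub_abs_le_abs_sub σ q
    have h2 : |σ - q| ≤ ε := abs_le.2 ⟨by linarith [hq.2], by linarith [hq.1]⟩
    linarith
  -- Otherwise an interval of length `ε` would lie in the slice outside `K`, a set of measure less
  -- than `ε`.
  have hgap : (Set.Icc σ (σ + ε) ∩ Atᶜ).Nonempty := by
    by_contra hempty
    rw [Set.not_nonempty_iff_eq_empty] at hempty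
    have hsub : Set.Icc σ (σ + ε) ⊆ At \ K := by
      intro q hq
      refine ⟨?_, fun hqK => ?_⟩
      · by_contra hqA
        exact (Set.eq_empty_iff_forall_notMem.1 hempty q) ⟨hq, hqA⟩
      · have := hR₁ q hqK
        rw [Real.norm_eq_abs] at this
        linarith [hfar q hq, le_max_left R₁ R₂]
    have := (MeasureTheory.measure_mono hsub).trans_lt hKε
    rw [Real.volume_Icc, add_sub_cancel_left] at this
    exact lt_irrefl _ this
  obtain ⟨p, ⟨hpI, hpA⟩, hpmin⟩ :=
    (isCompact_Icc.inter_right hAt.isClosed_compl).exists_isLeast hgap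
  have hσA : σ ∈ At := ⟨x, hjx⟩
  have hσp : σ < p := lt_of_le_of_ne hpI.1 fun h => hpA (h ▸ hσA)
  have hIA : ∀ q ∈ Set.Ico σ p, (t, q) ∈ Set.range j := by
    intro q hq
    by_contra hqA
    exact absurd (hpmin ⟨⟨hq.1, hq.2.le.trans hpI.2⟩, hqA⟩) (not_le.2 hq.2)
  -- The segment up to the gap has connected preimage. It starts below the level `c₀` and lies too
  -- far out to meet that level, so it stays below.
  let S : Set X := j ⁻¹' ((fun q : ℝ => (t, q)) '' Set.Ico σ p)
  have hS : IsPreconnected S := by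
    rw [← hj.isInducing.isPreconnected_image, Set.image_preimage_eq_of_subset]
    · exact isPreconnected_Ico.image _ (Continuous.prodMk_right t).continuousOn
    · rintro _ ⟨q, hq, rfl⟩
      exact hIA q hq
  have hxS : x ∈ S := ⟨σ, ⟨le_rfl, hσp⟩, hjx.symm⟩
  have hSlev : ∀ z ∈ S, lev z < c₀ := by
    intro z hz
    by_contra! hzc
    obtain ⟨w, ⟨q, hq, hqw⟩, hwc⟩ :=
      hS.intermediate_value hxS hz hlev.continuousOn ⟨hx.le, hzc⟩
    have h1 := hR₂ q ⟨j w, ⟨w, ⟨hwc.ge, hwc.le⟩, rfl⟩, by rw [← hqw]⟩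
    rw [Real.norm_eq_abs] at h1
    linarith [hfar q ⟨hq.1, hq.2.le.trans hpI.2⟩, le_max_right R₁ R₂]
  have hcl : (t, p) ∈ closure (j '' {x | lev x < c₀}) := by
    have hp : p ∈ closure (Set.Ico σ p) := by
      rw [closure_Ico hσp.ne]; exact ⟨hσp.le, le_rfl⟩
    refine closure_mono ?_ (image_closure_subset_closure_image
      (Continuous.prodMk_right t) ⟨p, hp, rfl⟩)
    rintro _ ⟨q, hq, rfl⟩
    obtain ⟨z, hz⟩ := hIA q hq
    exact ⟨z, hSlev z ⟨q, hq, hz.symm⟩, hz⟩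
  have hzero := hB _ (mem_lowerEnd_of_mem_closure hj.continuous hcpt hc₀ hcl hpA)
  have h := hF σ p (subset_closure ⟨x, hjx⟩) (closure_mono (Set.image_subset_range _ _) hcl)
  rw [hzero, sub_zero] at h
  have h2 : |σ - p| ≤ ε := abs_le.2 ⟨by linarith [hpI.2], by linarith [hpI.1]⟩
  have h3 : (L : ℝ) * |σ - p| ≤ L * ε := mul_le_mul_of_nonneg_left h2 L.2
  linarith [le_abs_self (F (t, σ))]

/-- A function that vanishes on the lower end is small on the intersection of a vertical line with
some circle that is close to the lower end. -/
theorem exists_level_lt (hj : Topology.IsOpenEmbedding j) (hlev : Continuous lev) (hab : a < b)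
    (hcpt : ∀ c d : ℝ, a < c → (d : EReal) < b → IsCompact {x | c ≤ lev x ∧ lev x ≤ d})
    {t : AddCircle l} (hvol : MeasureTheory.volume {σ : ℝ | (t, σ) ∈ Set.range j} ≠ ⊤)
    {F : AddCircle l × ℝ → ℝ} {L : ℝ≥0}
    (hF : ∀ σ σ' : ℝ, (t, σ) ∈ closure (Set.range j) → (t, σ') ∈ closure (Set.range j) →
      |F (t, σ) - F (t, σ')| ≤ L * |σ - σ'|)
    (hB : ∀ x ∈ lowerEnd j lev a b, F x = 0) {τ : ℝ} (hτ : 0 < τ) :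
    ∃ c : ℝ, a < c ∧ (c : EReal) < b ∧ ∀ x, lev x = c → (j x).1 = t → F (j x) < τ := by
  obtain ⟨c₀, hac₀, hc₀⟩ := EReal.lt_iff_exists_real_btwn.1 hab
  obtain ⟨R, hR⟩ := exists_abs_le_of_volume_lt_top hj hlev hcpt hvol hF hB hτ hac₀ hc₀
  by_contra! hcon
  let ι := {c : ℝ // a < c ∧ c ≤ c₀}
  -- If the claim fails, these nested sets are nonempty and uniformly bounded. A common point of
  -- their closures lies in the lower end, although values of `F` at least `τ` occur arbitrarily
  -- close to it.
  let D : ι → Set ℝ := fun c => {σ | ∃ x, lev x < c.1 ∧ j x = (t, σ) ∧ τ ≤ F (t, σ)}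
  have hDR : ∀ c, D c ⊆ Set.Icc (-R) R := by
    rintro c σ ⟨x, hx, hjx, hFσ⟩
    exact abs_le.1 (hR x σ (hx.trans_le c.2.2) hjx hFσ)
  have hDmono : ∀ c d : ι, c.1 ≤ d.1 → D c ⊆ D d := by
    rintro c d hcd σ ⟨x, hx, hjx⟩
    exact ⟨x, hx.trans_le hcd, hjx⟩
  have hDne : ∀ c, (D c).Nonempty := by
    intro c
    obtain ⟨d, had, hdc⟩ := EReal.lt_iff_exists_real_btwn.1 c.2.1
    have hdc' : d < c.1 := EReal.coe_lt_coe_iff.1 hdc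
    obtain ⟨x, hx, hxt, hFx⟩ := hcon d had
      ((EReal.coe_lt_coe_iff.2 (hdc'.trans_le c.2.2)).trans hc₀)
    have hjx : j x = (t, (j x).2) := Prod.ext hxt rfl
    exact ⟨(j x).2, x, hx ▸ hdc', hjx, hjx ▸ hFx⟩
  have : Nonempty ι := ⟨⟨c₀, hac₀, le_rfl⟩⟩
  obtain ⟨σ, hσ⟩ := IsCompact.nonempty_iInter_of_directed_nonempty_isCompact_isClosed
    (fun c => closure (D c)) (fun c d => by
      rcases le_total c.1 d.1 with h | h
      · exact ⟨c, subset_rfl, closure_mono (hDmono c d h)⟩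
      · exact ⟨d, closure_mono (hDmono d c h), subset_rfl⟩)
    (fun c => (hDne c).closure)
    (fun c => isCompact_Icc.of_isClosed_subset isClosed_closure
      (closure_minimal (hDR c) isClosed_Icc))
    (fun c => isClosed_closure)
  rw [Set.mem_iInter] at hσ
  have hcl : ∀ c : ι, (t, σ) ∈ closure (j '' {x | lev x < c.1}) := by
    intro c
    refine closure_mono ?_ (image_closure_subset_closure_image
      (Continuous.prodMk_right t) ⟨σ, hσ c, rfl⟩)
    rintro _ ⟨q, ⟨x, hx, hjx, -⟩, rfl⟩
    exact ⟨x, hx, hjx⟩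
  have hend : (t, σ) ∈ lowerEnd j lev a b := by
    refine Set.mem_iInter₂.2 fun c hc => ?_
    have hmin : a < ((min c c₀ : ℝ) : EReal) := by
      rcases min_choice c c₀ with h | h <;> rw [h]
      exacts [hc.1, hac₀]
    refine closure_mono (Set.image_mono fun x hx => ?_) (hcl ⟨min c c₀, hmin, min_le_right _ _⟩)
    exact (show lev x < min c c₀ from hx).trans_le (min_le_left _ _)
  have hzero := hB _ hend
  obtain ⟨δ, hδ, hLδ⟩ : ∃ δ : ℝ, 0 < δ ∧ L * δ < τ := by
    refine ⟨τ / (L + 1), by positivity, ?_⟩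
    rw [← mul_div_assoc, div_lt_iff₀ (by positivity)]
    nlinarith
  obtain ⟨q, ⟨x, -, hjx, hFq⟩, hq⟩ :=
    Metric.mem_closure_iff.1 (hσ ⟨c₀, hac₀, le_rfl⟩) δ hδ
  have h := hF σ q (closure_mono (Set.image_subset_range _ _) (hcl ⟨c₀, hac₀, le_rfl⟩))
    (subset_closure ⟨x, hjx⟩)
  rw [hzero, zero_sub, abs_neg] at h
  rw [Real.dist_eq] at hq
  have h3 : (L : ℝ) * |σ - q| ≤ L * δ := mul_le_mul_of_nonneg_left hq.le L.2
  linarith [le_abs_self (F (t, q))]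

end Ends

/-! ### Crossing an annulus along a vertical line -/

namespace Cylinder

variable {l : ℝ}

theorem isOpen_carrier (C : Cylinder l) : IsOpen C.carrier := by
  have h : Continuous fun p : AddCircle l × ℝ => (p.2 : EReal) :=
    continuous_coe_real_ereal.comp continuous_snd
  exact (isOpen_lt continuous_const h).inter (isOpen_lt h continuous_const)

theorem isCompact_levels [Fact (0 < l)] (C : Cylinder l) {c d : ℝ} (hc : C.a < c)
    (hd : (d : EReal) < C.b) : IsCompact {x : C.carrier | c ≤ x.1.2 ∧ x.1.2 ≤ d} := by
  rw [Topology.IsInducing.subtypeVal.isCompact_iff]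
  convert (isCompact_univ (X := AddCircle l)).prod (isCompact_Icc (a := c) (b := d)) using 1
  ext p
  constructor
  · rintro ⟨x, hx, rfl⟩
    exact ⟨trivial, hx⟩
  · rintro ⟨-, hp⟩
    exact ⟨⟨p, hc.trans_le (EReal.coe_le_coe_iff.2 hp.1),
      (EReal.coe_le_coe_iff.2 hp.2).trans_lt hd⟩, hp, rfl⟩

/-- A function that is `0` on the lower and `1` on the upper boundary of an annulus attains all
values in between on every vertical line which meets the annulus in a set of finite length. -/
theorem exists_eq_on_vertical (hl : 0 < l) (C : Cylinder l)
    {J : unitInterval → C.carrier → C.carrier}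
    (hJ : Continuous fun x : unitInterval × C.carrier => J x.1 x.2)
    (hJ0 : ∀ x, J 0 x = x)
    (hopen : Topology.IsOpenEmbedding fun x => (J 1 x : AddCircle l × ℝ))
    {t : AddCircle l}
    (hvol : MeasureTheory.volume
      {σ : ℝ | (t, σ) ∈ Set.range fun x => (J 1 x : AddCircle l × ℝ)} ≠ ⊤)
    {F : AddCircle l × ℝ → ℝ} {L : ℝ≥0}
    (hFc : ContinuousOn F (Set.range fun x => (J 1 x : AddCircle l × ℝ)))
    (hF : ∀ σ σ' : ℝ, (t, σ) ∈ closure (Set.range fun x => (J 1 x : AddCircle l × ℝ)) →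
      (t, σ') ∈ closure (Set.range fun x => (J 1 x : AddCircle l × ℝ)) →
      |F (t, σ) - F (t, σ')| ≤ L * |σ - σ'|)
    (hB₁ : ∀ y ∈ ⋂ c ∈ {c : ℝ | C.a < (c : EReal) ∧ (c : EReal) < C.b},
      closure ((fun x => (J 1 x : AddCircle l × ℝ)) '' {x : C.carrier | x.1.2 < c}), F y = 0)
    (hB₂ : ∀ y ∈ ⋂ c ∈ {c : ℝ | C.a < (c : EReal) ∧ (c : EReal) < C.b},
      closure ((fun x => (J 1 x : AddCircle l × ℝ)) '' {x : C.carrier | c < x.1.2}), F y = 1)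
    {τ : ℝ} (hτ0 : 0 < τ) (hτ1 : τ < 1) :
    ∃ σ : ℝ, (t, σ) ∈ (Set.range fun x => (J 1 x : AddCircle l × ℝ)) ∧ F (t, σ) = τ := by
  have : Fact (0 < l) := ⟨hl⟩
  set j : C.carrier → AddCircle l × ℝ := fun x => (J 1 x : AddCircle l × ℝ) with hj
  have hlev : Continuous fun x : C.carrier => x.1.2 := by fun_prop
  obtain ⟨c, hac, hcb, hc⟩ := exists_level_lt hopen hlev C.a_lt_b
    (fun _ _ hc hd => C.isCompact_levels hc hd) hvol hF hB₁ hτ0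
  -- Reversing the level function and replacing `F` by `1 - F` turns the upper end into a lower end.
  obtain ⟨d, hbd, hda, hd⟩ := exists_level_lt (lev := fun x : C.carrier => -x.1.2)
    (a := -C.b) (b := -C.a) (F := fun y => 1 - F y) (τ := 1 - τ)
    hopen hlev.neg (EReal.neg_lt_neg_iff.2 C.a_lt_b)
    (fun c d hc hd => by
      convert C.isCompact_levels (c := -d) (d := -c) (by
        rw [EReal.coe_neg]; exact EReal.lt_neg_comm.1 hd) (by
        rw [EReal.coe_neg]; exact EReal.neg_lt_comm.1 hc) using 1
      ext x
      simp only [Set.mem_ofPred_eq]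
      exact ⟨fun h => ⟨by linarith [h.2], by linarith [h.1]⟩,
        fun h => ⟨by linarith [h.2], by linarith [h.1]⟩⟩) hvol
    (fun σ σ' h h' => by
      have := hF σ' σ h' h
      rw [abs_sub_comm σ' σ] at this
      convert this using 2
      ring)
    (fun y hy => by
      rw [hB₂ y, sub_self]
      refine Set.mem_iInter₂.2 fun c hc => ?_
      have := Set.mem_iInter₂.1 hy (-c) ⟨by
        rw [EReal.coe_neg]; exact EReal.neg_lt_neg_iff.2 hc.2, by
        rw [EReal.coe_neg]; exact EReal.neg_lt_neg_iff.2 hc.1⟩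
      simpa only [neg_lt_neg_iff] using this) (by linarith)
  have had : C.a < ((-d : ℝ) : EReal) := by rw [EReal.coe_neg]; exact EReal.lt_neg_comm.1 hda
  have hdb : ((-d : ℝ) : EReal) < C.b := by rw [EReal.coe_neg]; exact EReal.neg_lt_comm.1 hbd
  have hmem : ∀ σ : unitInterval,
      C.a < ((AffineMap.lineMap c (-d) (σ : ℝ) : ℝ) : EReal) ∧
        ((AffineMap.lineMap c (-d) (σ : ℝ) : ℝ) : EReal) < C.b := by
    intro σ
    have hI : AffineMap.lineMap c (-d) (σ : ℝ) ∈ Set.uIcc c (-d) :=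
      (convex_uIcc c (-d)).lineMap_mem Set.left_mem_uIcc Set.right_mem_uIcc σ.2
    rw [Set.mem_uIcc] at hI
    rcases hI with h | h
    · exact ⟨hac.trans_le (EReal.coe_le_coe_iff.2 h.1), (EReal.coe_le_coe_iff.2 h.2).trans_lt hdb⟩
    · exact ⟨had.trans_le (EReal.coe_le_coe_iff.2 h.1), (EReal.coe_le_coe_iff.2 h.2).trans_lt hcb⟩
  -- These are the horizontal circles from height `c` to height `-d`; neither order of the two
  -- heights is assumed.
  let loop : unitInterval → ℝ → C.carrier := fun σ u =>
    ⟨(((u * l : ℝ) : AddCircle l), AffineMap.lineMap c (-d) (σ : ℝ)), hmem σ⟩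
  have hloop : Continuous fun x : unitInterval × ℝ => loop x.1 x.2 := by
    refine Continuous.subtype_mk (((AddCircle.continuous_mk' l).comp
      (continuous_snd.mul continuous_const)).prodMk ?_) _
    exact AffineMap.lineMap_continuous.comp (continuous_subtype_val.comp continuous_fst)
  have hper : ∀ σ, loop σ 1 = loop σ 0 := by
    intro σ
    simp [loop, AddCircle.coe_period]
  have hjc : Continuous j := hopen.continuous
  have hcirc : Continuous fun p : AddCircle l × ℝ => AddCircle.toCircle p.1 :=
    AddCircle.continuous_toCircle.comp continuous_fst
  have hFj : Continuous fun x => F (j x) := hFc.comp_continuous hjc fun x => ⟨x, rfl⟩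
  have hwind : HasWinding (fun u => ((AddCircle.toCircle (j (loop 1 u)).1 : Circle) : ℂ)) 1 := by
    refine HasWinding.of_homotopy
      (H := fun τ u => ((AddCircle.toCircle (J τ (loop 1 u)).1.1 : Circle) : ℂ)) ?_
      (fun _ _ => Circle.coe_ne_zero _) (fun τ => by rw [hper]) ?_
    · have h1 : Continuous fun x : unitInterval × ℝ => loop 1 x.2 :=
        hloop.comp (continuous_const.prodMk continuous_snd)
      exact continuous_subtype_val.comp (hcirc.comp (continuous_subtype_val.comp
        (hJ.comp (continuous_fst.prodMk h1))))
    · convert hasWinding_exp using 2 with u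
      rw [hJ0]
      simp only [loop, AddCircle.toCircle_apply_mk, Circle.coe_exp]
      congr 1
      push_cast
      field_simp [hl.ne']
  obtain ⟨σ, u, h1, h2⟩ := exists_eq_on_fiber
    (θ := fun σ u => AddCircle.toCircle (j (loop σ u)).1) (f := fun σ u => F (j (loop σ u)))
    (hcirc.comp (hjc.comp hloop)) (hFj.comp hloop) (fun σ => by rw [hper])
    (fun σ => by rw [hper]) hwind (AddCircle.toCircle t) τ
    (fun u hu => hc _ (by simp [loop]) (AddCircle.injective_toCircle hl.ne' hu))
    (fun u hu => by
      have := hd (loop 1 u) (by simp [loop]) (AddCircle.injective_toCircle hl.ne' hu)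
      linarith)
  have ht : (j (loop σ u)).1 = t := AddCircle.injective_toCircle hl.ne' h1
  have hjt : (t, (j (loop σ u)).2) = j (loop σ u) := Prod.ext ht.symm rfl
  exact ⟨(j (loop σ u)).2, ⟨loop σ u, hjt.symm⟩, by rw [hjt]; exact h2⟩

end Cylinder
end

noncomputable section

/-! ### The Riemannian distance and Lipschitz functions -/

namespace Cylinder

variable {l : ℝ} (C : Cylinder l)

/-- The straight coordinate segment stays in the closed strip and competes in the infimum. -/
theorem dist_le_of_speed_le {p q : ℝ × ℝ} (hpa : C.a ≤ p.2) (hpb : (p.2 : EReal) ≤ C.b)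
    (hqa : C.a ≤ q.2) (hqb : (q.2 : EReal) ≤ C.b) {N : ℝ}
    (h : ∀ τ ∈ Set.Icc (0 : ℝ) 1,
      Real.sqrt (metricInner C.G (p + τ • (q - p)) (q - p) (q - p)) ≤ N) :
    C.dist ((p.1 : AddCircle l), p.2) ((q.1 : AddCircle l), q.2) ≤ ENNReal.ofReal N := by
  have hd : ∀ τ : ℝ, HasDerivAt (fun τ : ℝ => p + τ • (q - p)) (q - p) τ := fun τ => by
    simpa using ((hasDerivAt_id τ).smul_const (q - p)).const_add p
  refine (iInf₂_le (fun τ : ℝ => p + τ • (q - p)) (by fun_prop)).trans <|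
    (iInf₂_le ?_ (by simp)).trans <| (iInf_le _ (by simp)).trans ?_
  · intro τ hτ
    have hI : p.2 + τ * (q.2 - p.2) ∈ Set.uIcc p.2 q.2 := by
      have := (convex_uIcc p.2 q.2).lineMap_mem Set.left_mem_uIcc Set.right_mem_uIcc hτ
      rw [AffineMap.lineMap_apply] at this
      simpa [add_comm] using this
    change C.a ≤ ((p.2 + τ * (q.2 - p.2) : ℝ) : EReal) ∧
      ((p.2 + τ * (q.2 - p.2) : ℝ) : EReal) ≤ C.b
    rw [Set.mem_uIcc] at hI
    rcases hI with h | h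
    · exact ⟨hpa.trans (EReal.coe_le_coe_iff.2 h.1), (EReal.coe_le_coe_iff.2 h.2).trans hqb⟩
    · exact ⟨hqa.trans (EReal.coe_le_coe_iff.2 h.1), (EReal.coe_le_coe_iff.2 h.2).trans hpb⟩
  · calc C.pathLength _ ≤ ∫⁻ _ in Set.Icc (0 : ℝ) 1, ENNReal.ofReal N := by
          refine MeasureTheory.setLIntegral_mono measurable_const fun τ hτ => ?_
          rw [(hd τ).deriv]
          exact ENNReal.ofReal_le_ofReal (h τ hτ)
      _ = ENNReal.ofReal N := by simp

theorem dist_vertical_le (t : AddCircle l) {σ σ' : ℝ} (ha : C.a ≤ σ) (hb : (σ : EReal) ≤ C.b)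
    (ha' : C.a ≤ σ') (hb' : (σ' : EReal) ≤ C.b) :
    C.dist (t, σ) (t, σ') ≤ ENNReal.ofReal |σ - σ'| := by
  obtain ⟨t, rfl⟩ := QuotientAddGroup.mk_surjective t
  refine C.dist_le_of_speed_le (p := (t, σ)) (q := (t, σ')) ha hb ha' hb' fun τ hτ => ?_
  have hI : σ + τ * (σ' - σ) ∈ Set.uIcc σ σ' := by
    have := (convex_uIcc σ σ').lineMap_mem Set.left_mem_uIcc Set.right_mem_uIcc hτ
    rw [AffineMap.lineMap_apply] at this
    simpa [add_comm] using this
  have h1 : C.G ((t, σ) + τ • ((t, σ') - (t, σ))) 1 1 = 1 := by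
    have : ((t, σ) : ℝ × ℝ) + τ • ((t, σ') - (t, σ)) = (t, σ + τ * (σ' - σ)) := by
      simp
    rw [this]
    rw [Set.mem_uIcc] at hI
    rcases hI with h | h
    · exact C.metric_one_one (ha.trans (EReal.coe_le_coe_iff.2 h.1))
        ((EReal.coe_le_coe_iff.2 h.2).trans hb')
    · exact C.metric_one_one (ha'.trans (EReal.coe_le_coe_iff.2 h.1))
        ((EReal.coe_le_coe_iff.2 h.2).trans hb)
  rw [metricInner_eq, h1]
  simp [← sq, Real.sqrt_sq_eq_abs, abs_sub_comm]

theorem exists_dist_le_edist {p : ℝ × ℝ} (hp : p ∈ C.strip) : ∃ M : ℝ≥0, ∃ V ∈ nhds p,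
    ∀ q ∈ V, ∀ r ∈ V, C.dist ((q.1 : AddCircle l), q.2) ((r.1 : AddCircle l), r.2) ≤
      M * edist q r := by
  have hcont : ContinuousAt (fun p => C.G p 0 0) p :=
    (C.contDiffAt_metric 0 0 (t := p.1) (C.mem_U_of_mem_strip hp)).continuousAt
  have hev : ∀ᶠ q in nhds p, C.G q 0 0 < C.G p 0 0 + 1 ∧ q ∈ C.strip :=
    (hcont.eventually_lt continuousAt_const (lt_add_one _)).and (C.eventually_mem_strip hp)
  obtain ⟨ε, hε, hball⟩ := Metric.eventually_nhds_iff_ball.1 hev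
  have hpos := C.metric_zero_zero_pos (t := p.1) (C.mem_U_of_mem_strip hp)
  -- Near `p` the entry `G 0 0` is below `G p 0 0 + 1`; the remaining `1` pays for the `ds²` term,
  -- both components being bounded by the sup norm.
  set m : ℝ := C.G p 0 0 + 2 with hm
  refine ⟨(Real.sqrt m).toNNReal, Metric.ball p ε, Metric.ball_mem_nhds p hε, fun q hq r hr => ?_⟩
  have hqs := (hball q hq).2
  have hrs := (hball r hr).2
  have h := C.dist_le_of_speed_le hqs.1.le hqs.2.le hrs.1.le hrs.2.le
    (N := Real.sqrt m * Dist.dist q r) fun τ hτ => by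
      have hmem : q + τ • (r - q) ∈ Metric.ball p ε := by
        have := (convex_ball p ε).lineMap_mem hq hr hτ
        rw [AffineMap.lineMap_apply] at this
        simpa [add_comm] using this
      obtain ⟨hlt, hs⟩ := hball _ hmem
      set z := q + τ • (r - q)
      rw [metricInner_eq, C.metric_one_one (t := z.1) hs.1.le hs.2.le,
        C.metric_one_zero (t := z.1) hs.1.le hs.2.le, C.metric_zero_one (t := z.1) hs.1.le hs.2.le]
      have hd : Dist.dist q r = ‖r - q‖ := by rw [dist_comm, dist_eq_norm]
      have h1 : |(r - q).1| ≤ ‖r - q‖ := norm_fst_le (r - q)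
      have h2 : |(r - q).2| ≤ ‖r - q‖ := norm_snd_le (r - q)
      have h1' : (r - q).1 * (r - q).1 ≤ ‖r - q‖ ^ 2 := by
        rw [← sq, ← sq_abs]; gcongr
      have h2' : (r - q).2 * (r - q).2 ≤ ‖r - q‖ ^ 2 := by
        rw [← sq, ← sq_abs]; gcongr
      rw [hd, Real.sqrt_le_left (by positivity), mul_pow, Real.sq_sqrt (by positivity)]
      have hzpos := C.metric_zero_zero_pos (t := z.1) (C.mem_U_of_mem_strip hs)
      have h3 : C.G z 0 0 * ((r - q).1 * (r - q).1) ≤ (C.G p 0 0 + 1) * ‖r - q‖ ^ 2 :=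
        mul_le_mul hlt.le h1' (mul_self_nonneg _) (by positivity)
      nlinarith
  refine h.trans ?_
  rw [ENNReal.ofReal_mul (Real.sqrt_nonneg _), edist_dist]
  rfl

theorem abs_sub_le_pathLength {c : ℝ → ℝ × ℝ} (hc : ContDiff ℝ 1 c)
    (hs : ∀ τ ∈ Set.Icc (0 : ℝ) 1, C.a ≤ ((c τ).2 : EReal) ∧ ((c τ).2 : EReal) ≤ C.b) :
    ENNReal.ofReal |(c 0).2 - (c 1).2| ≤ C.pathLength c := by
  have hc1 : ∀ τ, HasDerivAt c (deriv c τ) τ := fun τ =>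
    (hc.differentiable (by simp)).differentiableAt.hasDerivAt
  have hc2 : ∀ τ, HasDerivAt (fun τ => (c τ).2) (deriv c τ).2 τ := fun τ => (hc1 τ).snd
  have hcont : Continuous fun τ => (deriv c τ).2 :=
    continuous_snd.comp (hc.continuous_deriv (by simp))
  have hint := intervalIntegral.integral_eq_sub_of_hasDerivAt (a := 0) (b := 1)
    (fun τ _ => hc2 τ) (hcont.intervalIntegrable 0 1)
  rw [abs_sub_comm, ← hint, intervalIntegral.integral_of_le zero_le_one,
    ← MeasureTheory.integral_Icc_eq_integral_Ioc, ← Real.enorm_eq_ofReal_abs]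
  refine (MeasureTheory.enorm_integral_le_lintegral_enorm _).trans ?_
  refine MeasureTheory.setLIntegral_mono' measurableSet_Icc fun τ hτ => ?_
  obtain ⟨ha, hb⟩ := hs τ hτ
  rw [Real.enorm_eq_ofReal_abs]
  refine ENNReal.ofReal_le_ofReal (Real.abs_le_sqrt ?_)
  rw [metricInner_eq, C.metric_one_one (t := (c τ).1) ha hb,
    C.metric_one_zero (t := (c τ).1) ha hb, C.metric_zero_one (t := (c τ).1) ha hb]
  have := C.metric_zero_zero_pos (t := (c τ).1) (C.mem_U _ ha hb)
  have := mul_nonneg this.le (mul_self_nonneg (deriv c τ).1)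
  nlinarith

theorem abs_sub_le_dist (x y : AddCircle l × ℝ) : ENNReal.ofReal |x.2 - y.2| ≤ C.dist x y := by
  refine le_iInf₂ fun c hc => le_iInf₂ fun hs hx => le_iInf fun hy => ?_
  rw [← hx, ← hy]
  exact C.abs_sub_le_pathLength hc hs

variable {C}

theorem mem_closed_of_mem_closure {A : Set (AddCircle l × ℝ)} (hA : A ⊆ C.carrier)
    {x : AddCircle l × ℝ} (hx : x ∈ closure A) : C.a ≤ (x.2 : EReal) ∧ (x.2 : EReal) ≤ C.b := by
  have h : Continuous fun p : AddCircle l × ℝ => (p.2 : EReal) :=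
    continuous_coe_real_ereal.comp continuous_snd
  have hcl : IsClosed {p : AddCircle l × ℝ | C.a ≤ (p.2 : EReal) ∧ (p.2 : EReal) ≤ C.b} :=
    (isClosed_le continuous_const h).inter (isClosed_le h continuous_const)
  exact closure_minimal (fun p hp => show C.a ≤ (p.2 : EReal) ∧ (p.2 : EReal) ≤ C.b from
    ⟨(hA hp).1.le, (hA hp).2.le⟩) hcl hx

/-- The distance is that of the closed cylinder, so the vertical segment may leave `A`, and points
in different components of a slice are compared as well. -/
theorem abs_sub_le_of_lipschitz {A : Set (AddCircle l × ℝ)} (hA : A ⊆ C.carrier)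
    {F : AddCircle l × ℝ → ℝ} {L : ℝ≥0}
    (hL : ∀ x ∈ closure A, ∀ y ∈ closure A, edist (F x) (F y) ≤ L * C.dist x y)
    {t : AddCircle l} {σ σ' : ℝ} (h : (t, σ) ∈ closure A) (h' : (t, σ') ∈ closure A) :
    |F (t, σ) - F (t, σ')| ≤ L * |σ - σ'| := by
  have h1 := hL _ h _ h'
  obtain ⟨ha, hb⟩ := mem_closed_of_mem_closure hA h
  obtain ⟨ha', hb'⟩ := mem_closed_of_mem_closure hA h'
  have h2 := h1.trans (mul_le_mul_right (C.dist_vertical_le t ha hb ha' hb') (L : ℝ≥0∞))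
  rw [edist_dist, Real.dist_eq, ← ENNReal.ofReal_coe_nnreal,
    ← ENNReal.ofReal_mul (NNReal.coe_nonneg L)] at h2
  exact (ENNReal.ofReal_le_ofReal_iff (by positivity)).1 h2

/-- The points of the plane that lie over `A`. -/
def lift (A : Set (AddCircle l × ℝ)) : Set (ℝ × ℝ) := {p | ((p.1 : AddCircle l), p.2) ∈ A}

theorem continuous_proj : Continuous fun p : ℝ × ℝ => ((p.1 : AddCircle l), p.2) :=
  ((AddCircle.continuous_mk' l).comp continuous_fst).prodMk continuous_snd

theorem isOpenQuotientMap_proj :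
    IsOpenQuotientMap fun p : ℝ × ℝ => ((p.1 : AddCircle l), p.2) :=
  QuotientAddGroup.isOpenQuotientMap_mk.prodMap IsOpenQuotientMap.id

theorem exists_lipschitzOnWith {A : Set (AddCircle l × ℝ)} (hA : A ⊆ C.carrier) (hAo : IsOpen A)
    {F : AddCircle l × ℝ → ℝ} (hF : C.IsLip (closure A) F) {p : ℝ × ℝ} (hp : p ∈ lift A) :
    ∃ M : ℝ≥0, ∃ V ∈ nhds p,
      LipschitzOnWith M (fun q : ℝ × ℝ => F ((q.1 : AddCircle l), q.2)) V := by
  obtain ⟨L, hL⟩ := hF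
  obtain ⟨M, V, hV, hM⟩ := C.exists_dist_le_edist (p := p) (hA hp)
  refine ⟨L * M, V ∩ lift A, Filter.inter_mem hV ((hAo.preimage continuous_proj).mem_nhds hp), ?_⟩
  intro q hq r hr
  refine (hL _ (subset_closure hq.2) _ (subset_closure hr.2)).trans ?_
  rw [ENNReal.coe_mul, mul_assoc]
  exact mul_le_mul_right (hM q hq.1 r hr.1) _

theorem continuousOn_of_isLip {A : Set (AddCircle l × ℝ)} (hA : A ⊆ C.carrier) (hAo : IsOpen A)
    {F : AddCircle l × ℝ → ℝ} (hF : C.IsLip (closure A) F) : ContinuousOn F A := by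
  rintro ⟨x, s⟩ hx
  obtain ⟨t, rfl⟩ := QuotientAddGroup.mk_surjective x
  obtain ⟨M, V, hV, hM⟩ := exists_lipschitzOnWith hA hAo hF (p := (t, s)) hx
  exact ((isOpenQuotientMap_proj.continuousAt_comp_iff (x := (t, s))).1
    (hM.continuousOn.continuousAt hV)).continuousWithinAt

theorem ae_differentiableAt_of_isLip {A : Set (AddCircle l × ℝ)} (hA : A ⊆ C.carrier)
    (hAo : IsOpen A) {F : AddCircle l × ℝ → ℝ} (hF : C.IsLip (closure A) F) :
    ∀ᵐ p : ℝ × ℝ, p ∈ lift A →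
      DifferentiableAt ℝ (fun q : ℝ × ℝ => F ((q.1 : AddCircle l), q.2)) p := by
  refine MeasureTheory.measure_null_of_locally_null _ fun p hp => ?_
  rw [Set.mem_compl_iff, Set.mem_ofPred_eq, Classical.not_imp] at hp
  obtain ⟨M, V, hV, hM⟩ := exists_lipschitzOnWith hA hAo hF hp.1
  obtain ⟨O, hOV, hO, hpO⟩ := mem_nhds_iff.1 hV
  have hae := (hM.mono hOV).ae_differentiableWithinAt_of_mem (μ := MeasureTheory.volume)
  refine ⟨_, inter_mem_nhdsWithin _ (hO.mem_nhds hpO), MeasureTheory.measure_mono_null ?_ hae⟩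
  rintro q ⟨hq, hqO⟩ h
  rw [Set.mem_compl_iff, Set.mem_ofPred_eq, Classical.not_imp] at hq
  exact hq.2 ((h hqO).differentiableAt (hO.mem_nhds hqO))

end Cylinder

/-! ### Variation on a line -/

/-- The image has measure at least `1`, and the integral of `|g'|` bounds the measure of the image.
Exceptional points are harmless since a Lipschitz map preserves null sets. No connectedness of `O`
is needed. -/
theorem one_le_lintegral_of_Ioo_subset_image {O : Set ℝ} (hO : IsOpen O) {g d : ℝ → ℝ} {L : ℝ≥0}
    (hg : LipschitzOnWith L g O)
    (hd : ∀ᵐ s, s ∈ O → HasDerivAt g (d s) s) (himg : Set.Ioo (0 : ℝ) 1 ⊆ g '' O) :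
    1 ≤ ∫⁻ s in O, ENNReal.ofReal |d s| := by
  obtain ⟨N, hN, hNm, hN0⟩ := MeasureTheory.exists_measurable_superset_of_null
    (MeasureTheory.ae_iff.1 hd)
  have hgood : ∀ s ∈ O \ N, HasFDerivWithinAt g
      ((ContinuousLinearMap.toSpanSingleton ℝ (d s))) (O \ N) s := by
    intro s hs
    by_contra hcon
    refine hs.2 (hN ?_)
    rw [Set.mem_ofPred_eq, Classical.not_imp]
    exact ⟨hs.1, fun h => hcon h.hasFDerivAt.hasFDerivWithinAt⟩
  have h1 := MeasureTheory.addHaar_image_le_lintegral_abs_det_fderiv MeasureTheory.volume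
    (hO.measurableSet.diff hNm) hgood
  have h2 : MeasureTheory.volume (g '' (O ∩ N)) = 0 := by
    have := (hg.mono Set.inter_subset_left).hausdorffMeasure_image_le (s := O ∩ N) (d := 1)
      zero_le_one
    rw [MeasureTheory.hausdorffMeasure_real,
      MeasureTheory.measure_mono_null Set.inter_subset_right hN0, mul_zero] at this
    exact le_antisymm this bot_le
  calc (1 : ℝ≥0∞) = MeasureTheory.volume (Set.Ioo (0 : ℝ) 1) := by simp
    _ ≤ MeasureTheory.volume (g '' (O \ N) ∪ g '' (O ∩ N)) := by
        rw [← Set.image_union, Set.sdiff_union_inter]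
        exact MeasureTheory.measure_mono himg
    _ ≤ MeasureTheory.volume (g '' (O \ N)) := by
        refine (MeasureTheory.measure_union_le _ _).trans ?_
        rw [h2, add_zero]
    _ ≤ ∫⁻ s in O \ N, ENNReal.ofReal |d s| := by
        simpa using h1
    _ ≤ ∫⁻ s in O, ENNReal.ofReal |d s| :=
        MeasureTheory.lintegral_mono_set Set.sdiff_subset
end

noncomputable section

/-! ### The lower bound of the capacity -/

namespace Cylinder

variable {l : ℝ} {C : Cylinder l}

theorem coordSet_eq (A : Set (AddCircle l × ℝ)) :
    coordSet A = Set.Ico 0 l ×ˢ Set.univ ∩ lift A := by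
  ext p
  exact ⟨fun h => ⟨⟨⟨h.1, h.2.1⟩, trivial⟩, h.2.2⟩, fun h => ⟨h.1.1.1, h.1.1.2, h.2⟩⟩

theorem measurableSet_coordSet {A : Set (AddCircle l × ℝ)} (hAo : IsOpen A) :
    MeasurableSet (coordSet A) := by
  rw [coordSet_eq]
  exact (measurableSet_Ico.prod MeasurableSet.univ).inter
    (hAo.preimage continuous_proj).measurableSet

theorem mem_strip_of_mem_coordSet {A : Set (AddCircle l × ℝ)} (hA : A ⊆ C.carrier) {p : ℝ × ℝ}
    (hp : p ∈ coordSet A) : p ∈ C.strip :=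
  hA hp.2.2

theorem sqrt_det_metric {p : ℝ × ℝ} (hp : p ∈ C.strip) :
    Real.sqrt (C.G p).det = Real.sqrt (C.G p 0 0) := by
  rw [C.det_metric (t := p.1) hp.1.le hp.2.le]

theorem cosh_le_sqrt_det {k : ℝ} (hK : ∀ p ∈ C.strip, gaussCurvature C.G p ≤ -k ^ 2)
    {p : ℝ × ℝ} (hp : p ∈ C.strip) : Real.cosh (k * p.2) ≤ Real.sqrt (C.G p).det := by
  rw [sqrt_det_metric hp]
  have := C.lengthElement_comparison (k := k) (ε := 1) (t := p.1) hp.1.le hp.2.le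
    fun q hq => by linarith [hK q hq]
  simpa using this

theorem volume_coordSet_le_area {k : ℝ} (hK : ∀ p ∈ C.strip, gaussCurvature C.G p ≤ -k ^ 2)
    {A : Set (AddCircle l × ℝ)} (hA : A ⊆ C.carrier) (hAo : IsOpen A) :
    MeasureTheory.volume (coordSet A) ≤ C.area A := by
  rw [← MeasureTheory.setLIntegral_one]
  refine MeasureTheory.setLIntegral_mono' (measurableSet_coordSet hAo) fun p hp => ?_
  rw [← ENNReal.ofReal_one]
  exact ENNReal.ofReal_le_ofReal ((Real.one_le_cosh _).trans
    (cosh_le_sqrt_det hK (mem_strip_of_mem_coordSet hA hp)))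

theorem fiber_coordSet {A : Set (AddCircle l × ℝ)} {t : ℝ} (ht : t ∈ Set.Ico 0 l) :
    Prod.mk t ⁻¹' coordSet A = {σ : ℝ | ((t : AddCircle l), σ) ∈ A} := by
  ext σ
  exact ⟨fun h => h.2.2, fun h => ⟨ht.1, ht.2, h⟩⟩

theorem isOpenEmbedding_of_isotopy (hl : 0 < l) {J : unitInterval → C.carrier → C.carrier}
    (hJ : Continuous fun x : unitInterval × C.carrier => J x.1 x.2)
    (hemb : ∀ τ, Topology.IsEmbedding (J τ)) (hJ0 : ∀ x, J 0 x = x) :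
    Topology.IsOpenEmbedding fun x => (J 1 x : AddCircle l × ℝ) := by
  refine ⟨Topology.IsEmbedding.subtypeVal.comp (hemb 1), ?_⟩
  exact isOpen_range_of_isotopy hl C.isOpen_carrier
    (J := fun τ x => (J τ x : AddCircle l × ℝ)) (continuous_subtype_val.comp hJ)
    (fun τ => Subtype.val_injective.comp (hemb τ).injective) (fun x => by rw [hJ0])

/-- By Fubini almost every vertical line meets `A` in finite length and has `F` differentiable
almost everywhere on its slice. Each such line contributes at least `1`. -/
theorem ofReal_le_lintegral_abs_pd (hl : 0 < l) {k : ℝ}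
    (hK : ∀ p ∈ C.strip, gaussCurvature C.G p ≤ -k ^ 2)
    {A B₁ B₂ : Set (AddCircle l × ℝ)} (hann : C.IsAnnulus A B₁ B₂) (harea : C.area A < ⊤)
    {F : AddCircle l × ℝ → ℝ} (hF : C.IsLip (closure A) F) (hB₁ : ∀ x ∈ B₁, F x = 0)
    (hB₂ : ∀ x ∈ B₂, F x = 1) :
    ENNReal.ofReal l ≤ ∫⁻ p in coordSet A,
      ENNReal.ofReal |pd 1 (fun q => F ((q.1 : AddCircle l), q.2)) p| := by
  obtain ⟨J, hJ, hemb, hJ0, rfl, rfl, rfl⟩ := hann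
  have hopen := isOpenEmbedding_of_isotopy hl hJ hemb hJ0
  set A := Set.range fun x => (J 1 x : AddCircle l × ℝ) with hAdef
  have hAo : IsOpen A := hopen.isOpen_range
  have hA : A ⊆ C.carrier := by
    rintro _ ⟨x, rfl⟩
    exact (J 1 x).2
  have hT := measurableSet_coordSet hAo
  have hvol := (volume_coordSet_le_area hK hA hAo).trans_lt harea
  rw [MeasureTheory.Measure.volume_eq_prod] at hvol
  have hfin := MeasureTheory.Measure.ae_measure_lt_top hT hvol.ne
  have hdiff := ae_differentiableAt_of_isLip hA hAo hF
  rw [MeasureTheory.Measure.volume_eq_prod] at hdiff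
  have hdiff' := MeasureTheory.Measure.ae_ae_of_ae_prod hdiff
  have hcont := continuousOn_of_isLip hA hAo hF
  have hmeas : Measurable fun p : ℝ × ℝ =>
      ENNReal.ofReal |pd 1 (fun q => F ((q.1 : AddCircle l), q.2)) p| := by
    have h1 : Measurable fun p : ℝ × ℝ => pd 1 (fun q => F ((q.1 : AddCircle l), q.2)) p :=
      measurable_fderiv_apply_const ℝ _ _
    exact h1.abs.ennreal_ofReal
  rw [← MeasureTheory.lintegral_indicator hT, MeasureTheory.Measure.volume_eq_prod,
    MeasureTheory.lintegral_prod _ (hmeas.indicator hT).aemeasurable]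
  calc ENNReal.ofReal l = ∫⁻ t : ℝ, (Set.Ico 0 l).indicator 1 t := by
        rw [MeasureTheory.lintegral_indicator_one measurableSet_Ico]; simp
    _ ≤ _ := by
        refine MeasureTheory.lintegral_mono_ae ?_
        filter_upwards [hfin, hdiff'] with t htfin htdiff
        by_cases ht : t ∈ Set.Ico 0 l
        · rw [Set.indicator_of_mem ht, Pi.one_apply]
          rw [fiber_coordSet ht] at htfin
          set O : Set ℝ := {σ : ℝ | ((t : AddCircle l), σ) ∈ A} with hO
          have hOo : IsOpen O := hAo.preimage (Continuous.prodMk_right _)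
          have hind : ∀ σ, (coordSet A).indicator (fun p : ℝ × ℝ =>
              ENNReal.ofReal |pd 1 (fun q => F ((q.1 : AddCircle l), q.2)) p|) (t, σ) =
              O.indicator (fun σ => ENNReal.ofReal
                |pd 1 (fun q => F ((q.1 : AddCircle l), q.2)) (t, σ)|) σ := by
            intro σ
            rw [hO, ← fiber_coordSet ht]
            rfl
          simp only [hind]
          rw [MeasureTheory.lintegral_indicator hOo.measurableSet]
          obtain ⟨L, hL⟩ := hF
          have hlip : ∀ σ σ' : ℝ, ((t : AddCircle l), σ) ∈ closure A →
              ((t : AddCircle l), σ') ∈ closure A →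
              |F ((t : AddCircle l), σ) - F ((t : AddCircle l), σ')| ≤ L * |σ - σ'| :=
            fun σ σ' h h' => abs_sub_le_of_lipschitz hA hL h h'
          refine one_le_lintegral_of_Ioo_subset_image hOo (L := L)
            (g := fun σ => F ((t : AddCircle l), σ)) ?_ ?_ ?_
          · exact LipschitzOnWith.of_dist_le_mul fun σ hσ σ' hσ' =>
              hlip σ σ' (subset_closure hσ) (subset_closure hσ')
          · filter_upwards [htdiff] with σ hσ hσO
            exact hasDerivAt_snd_of_differentiableAt (hσ hσO)
          · rintro τ ⟨h0, h1⟩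
            obtain ⟨σ, hσ, hFσ⟩ := C.exists_eq_on_vertical hl hJ hJ0 hopen
              (t := (t : AddCircle l)) htfin.ne hcont hlip hB₁ hB₂ h0 h1
            exact ⟨σ, hσ, hFσ⟩
        · rw [Set.indicator_of_notMem ht]
          exact zero_le

end Cylinder

/-! ### Integrals of hyperbolic functions -/

theorem hasDerivAt_h₁ (x : ℝ) : HasDerivAt h₁ (1 / Real.cosh x) x := by
  have h := ((Real.hasDerivAt_exp x).arctan).const_mul 2
  refine h.congr_deriv ?_
  rw [Real.cosh_eq, Real.exp_neg]
  have := Real.exp_pos x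
  field_simp
  ring

theorem h₁_strictMono : StrictMono h₁ := fun _ _ h =>
  mul_lt_mul_of_pos_left (Real.arctan_strictMono (Real.exp_lt_exp.2 h)) two_pos

theorem integral_inv_cosh {k : ℝ} (hk : k ≠ 0) (w : ℝ) :
    ∫ s in -w..w, 1 / Real.cosh (k * s) = (h₁ (k * w) - h₁ (-(k * w))) / k := by
  have hd : ∀ s, HasDerivAt (fun s => h₁ (k * s) / k) (1 / Real.cosh (k * s)) s := fun s => by
    have h := ((hasDerivAt_h₁ (k * s)).comp s ((hasDerivAt_id s).const_mul k)).div_const k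
    refine h.congr_deriv ?_
    field_simp
  have hc : Continuous fun s => 1 / Real.cosh (k * s) :=
    continuous_const.div (by fun_prop) fun s => (Real.cosh_pos _).ne'
  rw [intervalIntegral.integral_eq_sub_of_hasDerivAt (fun s _ => hd s) (hc.intervalIntegrable _ _),
    mul_neg]
  ring

theorem integral_cosh_mul {k : ℝ} (hk : k ≠ 0) (w : ℝ) :
    ∫ s in -w..w, Real.cosh (k * s) = 2 * Real.sinh (k * w) / k := by
  have hd : ∀ s, HasDerivAt (fun s => Real.sinh (k * s) / k) (Real.cosh (k * s)) s := fun s => by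
    have h := (((hasDerivAt_id s).const_mul k).sinh).div_const k
    refine h.congr_deriv ?_
    field_simp
    simp
  rw [intervalIntegral.integral_eq_sub_of_hasDerivAt (fun s _ => hd s)
    (Continuous.intervalIntegrable (by fun_prop) _ _), mul_neg, Real.sinh_neg]
  ring

theorem setLIntegral_strip {l : ℝ} {S : Set ℝ} {g : ℝ → ℝ≥0∞} (hg : Measurable g) :
    ∫⁻ p in Set.Ico 0 l ×ˢ S, g p.2 = ENNReal.ofReal l * ∫⁻ s in S, g s := by
  rw [MeasureTheory.Measure.volume_eq_prod, ← MeasureTheory.Measure.prod_restrict]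
  have := MeasureTheory.lintegral_prod_mul
    (μ := MeasureTheory.volume.restrict (Set.Ico 0 l)) (ν := MeasureTheory.volume.restrict S)
    (f := fun _ => 1) (g := g) aemeasurable_const hg.aemeasurable
  simpa using this

theorem setLIntegral_Icc_ofReal {w : ℝ} (hw : 0 ≤ w) {g : ℝ → ℝ} (hg : Continuous g)
    (hpos : ∀ s ∈ Set.Icc (-w) w, 0 ≤ g s) :
    ∫⁻ s in Set.Icc (-w) w, ENNReal.ofReal (g s) = ENNReal.ofReal (∫ s in -w..w, g s) := by
  rw [intervalIntegral.integral_of_le (by linarith), ← MeasureTheory.integral_Icc_eq_integral_Ioc,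
    MeasureTheory.ofReal_integral_eq_lintegral_ofReal hg.integrableOn_Icc]
  exact (MeasureTheory.ae_restrict_iff' measurableSet_Icc).2 (Filter.Eventually.of_forall hpos)

theorem cosh_le_cosh_of_abs_le {k w s : ℝ} (hk : 0 < k) (h : |s| ≤ w) :
    Real.cosh (k * s) ≤ Real.cosh (k * w) := by
  rw [Real.cosh_le_cosh, abs_mul, abs_mul, abs_of_pos hk]
  exact mul_le_mul_of_nonneg_left (h.trans (le_abs_self w)) hk.le

/-- The bathtub inequality for the reciprocal of a function that is at least `cosh (k s)`. -/
theorem inv_le_of_cosh_le {k w s f : ℝ} (hk : 0 < k) (hw : 0 ≤ w) (hf : Real.cosh (k * s) ≤ f) :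
    1 / f ≤ f * (1 / Real.cosh (k * w) ^ 2) + (Set.Icc (-w) w).indicator
      (fun s => 1 / Real.cosh (k * s) - Real.cosh (k * s) * (1 / Real.cosh (k * w) ^ 2)) s := by
  have hc := Real.cosh_pos (k * w)
  have hs := Real.cosh_pos (k * s)
  have hfpos := hs.trans_le hf
  -- Inside, `1/f - c f` with `c = 1 / cosh² (k w)` decreases in `f`, so `f` may be replaced by
  -- `cosh (k s)`. Outside, `f ≥ cosh (k w)` makes it nonpositive.
  by_cases h : s ∈ Set.Icc (-w) w
  · rw [Set.indicator_of_mem h]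
    have h1 : 1 / f ≤ 1 / Real.cosh (k * s) := one_div_le_one_div_of_le hs hf
    have h2 : Real.cosh (k * s) * (1 / Real.cosh (k * w) ^ 2) ≤ f * (1 / Real.cosh (k * w) ^ 2) :=
      mul_le_mul_of_nonneg_right hf (by positivity)
    linarith
  · rw [Set.indicator_of_notMem h, add_zero]
    have h1 : w ≤ |s| := by
      by_contra! h'
      exact h (abs_le.1 h'.le)
    have h2 : Real.cosh (k * w) ≤ f := by
      refine le_trans ?_ hf
      rw [Real.cosh_le_cosh, abs_mul, abs_mul, abs_of_pos hk, abs_of_nonneg hw]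
      exact mul_le_mul_of_nonneg_left h1 hk.le
    rw [mul_one_div, div_le_div_iff₀ hfpos (by positivity)]
    nlinarith

end

/-! ### The energy inequality and the choice of its parameters -/

noncomputable section

namespace Cylinder

variable {l : ℝ} {C : Cylinder l}

theorem energyDensity_eq {p : ℝ × ℝ} (hp : p ∈ C.strip) (v : Fin 2 → ℝ) :
    (∑ i, ∑ j, (C.G p)⁻¹ i j * v i * v j) * Real.sqrt (C.G p).det =
      ((C.G p 0 0)⁻¹ * v 0 ^ 2 + v 1 ^ 2) * Real.sqrt (C.G p).det := by
  rw [C.inv_metric (t := p.1) hp.1.le hp.2.le]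
  simp [Fin.sum_univ_two]
  left
  ring

theorem aemeasurable_areaDensity {A : Set (AddCircle l × ℝ)} (hA : A ⊆ C.carrier)
    (hAo : IsOpen A) : AEMeasurable (fun p => ENNReal.ofReal (Real.sqrt (C.G p).det))
      (MeasureTheory.volume.restrict (coordSet A)) := by
  have h1 : ContinuousOn (fun p => Real.sqrt (C.G p 0 0)) C.strip := fun p hp =>
    ((C.contDiffAt_metric 0 0 (t := p.1)
      (C.mem_U_of_mem_strip hp)).continuousAt.sqrt).continuousWithinAt
  have hT := measurableSet_coordSet hAo
  have h2 := (h1.mono fun p hp => mem_strip_of_mem_coordSet hA hp).aemeasurable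
    (μ := MeasureTheory.volume) hT
  refine h2.ennreal_ofReal.congr ?_
  refine (MeasureTheory.ae_restrict_iff' hT).2 (Filter.Eventually.of_forall fun p hp => ?_)
  simp only
  rw [sqrt_det_metric (mem_strip_of_mem_coordSet hA hp)]

theorem two_mul_abs_le {I x f y : ℝ} (hI : 0 < I) (hf : 0 < f) (hy : 1 / f ≤ y) :
    2 * |x| ≤ I * (x ^ 2 * f) + 1 / I * y := by
  have h1 : 2 * |x| ≤ I * (x ^ 2 * f) + 1 / I * (1 / f) := by
    have h2 : I * (x ^ 2 * f) + 1 / I * (1 / f) - 2 * |x| = (I * f * |x| - 1) ^ 2 / (I * f) := by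
      field_simp
      rw [← sq_abs x]
      ring
    have h3 : 0 ≤ (I * f * |x| - 1) ^ 2 / (I * f) := by positivity
    linarith
  have h4 : 1 / I * (1 / f) ≤ 1 / I * y := mul_le_mul_of_nonneg_left hy (by positivity)
  linarith

/-- The energy inequality on an annulus, with the reciprocal of the length element replaced by the
bathtub bound. -/
theorem two_mul_le_energy_add {k w I : ℝ} (hk : 0 < k) (hl : 0 < l) (hw : 0 ≤ w) (hI : 0 < I)
    (hK : ∀ p ∈ C.strip, gaussCurvature C.G p ≤ -k ^ 2)
    {A B₁ B₂ : Set (AddCircle l × ℝ)} (hann : C.IsAnnulus A B₁ B₂) (harea : C.area A < ⊤)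
    {F : AddCircle l × ℝ → ℝ} (hF : C.IsLip (closure A) F) (hB₁ : ∀ x ∈ B₁, F x = 0)
    (hB₂ : ∀ x ∈ B₂, F x = 1) :
    2 * ENNReal.ofReal l ≤ ENNReal.ofReal I * C.energy A F + ENNReal.ofReal (1 / I) *
      (C.area A * ENNReal.ofReal (1 / Real.cosh (k * w) ^ 2) + ENNReal.ofReal l *
        ENNReal.ofReal (∫ s in -w..w, (1 / Real.cosh (k * s) -
          Real.cosh (k * s) * (1 / Real.cosh (k * w) ^ 2)))) := by
  have hmain := ofReal_le_lintegral_abs_pd hl hK hann harea hF hB₁ hB₂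
  have hA : A ⊆ C.carrier := by
    obtain ⟨J, -, -, -, rfl, -⟩ := hann
    rintro _ ⟨x, rfl⟩
    exact (J 1 x).2
  have hAo : IsOpen A := by
    obtain ⟨J, hJ, hemb, hJ0, rfl, -⟩ := hann
    exact (isOpenEmbedding_of_isotopy hl hJ hemb hJ0).isOpen_range
  have hT := measurableSet_coordSet hAo
  set c := 1 / Real.cosh (k * w) ^ 2 with hc
  have hcpos : 0 < c := by have := Real.cosh_pos (k * w); positivity
  let ψ : ℝ → ℝ := fun s => 1 / Real.cosh (k * s) - Real.cosh (k * s) * c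
  have hψ : Continuous ψ := by
    have : Continuous fun s => 1 / Real.cosh (k * s) :=
      continuous_const.div (by fun_prop) fun s => (Real.cosh_pos _).ne'
    exact this.sub (by fun_prop)
  have hψpos : ∀ s ∈ Set.Icc (-w) w, 0 ≤ ψ s := by
    intro s hs
    have h1 := cosh_le_cosh_of_abs_le hk (abs_le.2 hs)
    have h2 := Real.cosh_pos (k * s)
    have h3 := Real.cosh_pos (k * w)
    simp only [ψ, hc]
    rw [sub_nonneg, mul_one_div, div_le_div_iff₀ (by positivity) h2, one_mul]
    nlinarith
  let φ : ℝ → ℝ := (Set.Icc (-w) w).indicator ψ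
  have hφ0 : ∀ s, 0 ≤ φ s := fun s => Set.indicator_nonneg hψpos s
  have hφm : Measurable φ := hψ.measurable.indicator measurableSet_Icc
  have hareaM := aemeasurable_areaDensity hA hAo
  set fd : ℝ × ℝ → ℝ := fun p => Real.sqrt (C.G p).det with hfd
  set D : ℝ × ℝ → ℝ := fun p => (∑ i, ∑ j, (C.G p)⁻¹ i j *
    pd i (fun q => F ((q.1 : AddCircle l), q.2)) p *
    pd j (fun q => F ((q.1 : AddCircle l), q.2)) p) * Real.sqrt (C.G p).det with hD
  have hpoint : ∀ p ∈ coordSet A,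
      2 * ENNReal.ofReal |pd 1 (fun q => F ((q.1 : AddCircle l), q.2)) p| ≤
      ENNReal.ofReal I * ENNReal.ofReal (D p) + ENNReal.ofReal (1 / I) *
        (ENNReal.ofReal (fd p) * ENNReal.ofReal c + ENNReal.ofReal (φ p.2)) := by
    intro p hp
    have hs := mem_strip_of_mem_coordSet hA hp
    have hcosh := cosh_le_sqrt_det hK hs
    have hfpos : 0 < fd p := (Real.cosh_pos _).trans_le hcosh
    have hGpos := C.metric_zero_zero_pos (t := p.1) (C.mem_U_of_mem_strip hs)
    -- The `t`-derivative is discarded.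
    have hDle : pd 1 (fun q => F ((q.1 : AddCircle l), q.2)) p ^ 2 * fd p ≤ D p := by
      have := energyDensity_eq hs fun i => pd i (fun q => F ((q.1 : AddCircle l), q.2)) p
      simp only [hD, this]
      refine mul_le_mul_of_nonneg_right (le_add_of_nonneg_left ?_) hfpos.le
      exact mul_nonneg (inv_nonneg.2 hGpos.le) (sq_nonneg _)
    have hreal := two_mul_abs_le (x := pd 1 (fun q => F ((q.1 : AddCircle l), q.2)) p) hI hfpos
      (inv_le_of_cosh_le hk hw hcosh)
    have hD0 : 0 ≤ D p := le_trans (by positivity) hDle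
    rw [← ENNReal.ofReal_mul hfpos.le, ← ENNReal.ofReal_add (by positivity) (hφ0 _),
      ← ENNReal.ofReal_mul hI.le, ← ENNReal.ofReal_mul (by positivity),
      ← ENNReal.ofReal_add (by positivity)
        (mul_nonneg (by positivity) (add_nonneg (by positivity) (hφ0 _))),
      ← ENNReal.ofReal_ofNat 2, ← ENNReal.ofReal_mul zero_le_two]
    refine ENNReal.ofReal_le_ofReal (hreal.trans ?_)
    have := mul_le_mul_of_nonneg_left hDle hI.le
    exact add_le_add_left this _
  -- As `φ ≥ 0`, the integral may be extended from `A` to all heights, even those beyond the ends of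
  -- the cylinder.
  have hφint : ∫⁻ p in coordSet A, ENNReal.ofReal (φ p.2) ≤
      ENNReal.ofReal l * ENNReal.ofReal (∫ s in -w..w, ψ s) := by
    calc ∫⁻ p in coordSet A, ENNReal.ofReal (φ p.2)
        ≤ ∫⁻ p in Set.Ico 0 l ×ˢ Set.univ, ENNReal.ofReal (φ p.2) := by
          refine MeasureTheory.lintegral_mono_set ?_
          rw [coordSet_eq]
          exact Set.inter_subset_left
      _ = ENNReal.ofReal l * ∫⁻ s, ENNReal.ofReal (φ s) := by
          rw [setLIntegral_strip hφm.ennreal_ofReal, MeasureTheory.Measure.restrict_univ]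
      _ = ENNReal.ofReal l * ∫⁻ s in Set.Icc (-w) w, ENNReal.ofReal (ψ s) := by
          rw [← MeasureTheory.lintegral_indicator measurableSet_Icc]
          congr 2
          ext s
          by_cases h : s ∈ Set.Icc (-w) w <;> simp [φ, h]
      _ = _ := by rw [setLIntegral_Icc_ofReal hw hψ hψpos]
  have hfdM : AEMeasurable (fun p => ENNReal.ofReal (fd p) * ENNReal.ofReal c)
      (MeasureTheory.volume.restrict (coordSet A)) := hareaM.mul_const _
  have hφM : Measurable fun p : ℝ × ℝ => ENNReal.ofReal (φ p.2) :=
    (hφm.comp measurable_snd).ennreal_ofReal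
  have hsumM : AEMeasurable (fun p => ENNReal.ofReal (1 / I) *
      (ENNReal.ofReal (fd p) * ENNReal.ofReal c + ENNReal.ofReal (φ p.2)))
      (MeasureTheory.volume.restrict (coordSet A)) := (hfdM.add hφM.aemeasurable).const_mul _
  calc 2 * ENNReal.ofReal l
      ≤ 2 * ∫⁻ p in coordSet A,
        ENNReal.ofReal |pd 1 (fun q => F ((q.1 : AddCircle l), q.2)) p| := by gcongr
    _ = ∫⁻ p in coordSet A,
        2 * ENNReal.ofReal |pd 1 (fun q => F ((q.1 : AddCircle l), q.2)) p| := by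
        rw [MeasureTheory.lintegral_const_mul' _ _ (by simp)]
    _ ≤ ∫⁻ p in coordSet A, (ENNReal.ofReal I * ENNReal.ofReal (D p) + ENNReal.ofReal (1 / I) *
        (ENNReal.ofReal (fd p) * ENNReal.ofReal c + ENNReal.ofReal (φ p.2))) :=
        MeasureTheory.setLIntegral_mono' hT hpoint
    _ = ENNReal.ofReal I * C.energy A F + ENNReal.ofReal (1 / I) *
        (C.area A * ENNReal.ofReal c + ∫⁻ p in coordSet A, ENNReal.ofReal (φ p.2)) := by
        rw [MeasureTheory.lintegral_add_right' _ hsumM,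
          MeasureTheory.lintegral_const_mul' _ _ ENNReal.ofReal_ne_top,
          MeasureTheory.lintegral_const_mul' _ _ ENNReal.ofReal_ne_top,
          MeasureTheory.lintegral_add_left' hfdM,
          MeasureTheory.lintegral_mul_const' _ _ ENNReal.ofReal_ne_top]
        rfl
    _ ≤ _ := by gcongr

/-- The energy inequality is used with `w = W / k`, so that the comparison collar has the area of
`A`, and with `I = N / k`, the integral of `1 / cosh (k s)` over it. -/
theorem ofReal_capacityBound_le_energy {k : ℝ} (hk : 0 < k) (hl : 0 < l)
    (hK : ∀ p ∈ C.strip, gaussCurvature C.G p ≤ -k ^ 2)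
    {A B₁ B₂ : Set (AddCircle l × ℝ)} (hann : C.IsAnnulus A B₁ B₂) (harea : C.area A < ⊤)
    {F : AddCircle l × ℝ → ℝ} (hF : C.IsLip (closure A) F) (hB₁ : ∀ x ∈ B₁, F x = 0)
    (hB₂ : ∀ x ∈ B₂, F x = 1) :
    ENNReal.ofReal (capacityBound k l (C.area A).toReal) ≤ C.energy A F := by
  rcases eq_or_ne (C.energy A F) ⊤ with hE | hE
  · rw [hE]; exact le_top
  set α := (C.area A).toReal with hα
  have hα0 : 0 ≤ α := ENNReal.toReal_nonneg
  rw [capacityBound]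
  set W := Real.arsinh (k * α / (2 * l)) with hW
  set N := h₁ W - h₁ (-W) with hN
  -- For zero area the denominator `N` is `0`, and division by zero makes the bound `0`.
  rcases hα0.eq_or_lt with h0 | hαpos
  · have : N = 0 := by simp [hN, hW, ← h0]
    simp [this]
  have hWpos : 0 < W := Real.arsinh_pos_iff.2 (by positivity)
  have hNpos : 0 < N := sub_pos.2 (h₁_strictMono (by linarith))
  have hkw : k * (W / k) = W := by field_simp
  have hsinh : Real.sinh W = k * α / (2 * l) := Real.sinh_arsinh _
  have hw : 0 ≤ W / k := by positivity
  have hI : 0 < N / k := by positivity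
  have key := two_mul_le_energy_add hk hl hw hI hK hann harea hF hB₁ hB₂
  set c := 1 / Real.cosh (k * (W / k)) ^ 2 with hc
  have hcpos : 0 < c := by have := Real.cosh_pos (k * (W / k)); positivity
  have hint : ∫ s in -(W / k)..(W / k), (1 / Real.cosh (k * s) - Real.cosh (k * s) * c) =
      N / k - α / l * c := by
    rw [intervalIntegral.integral_sub, intervalIntegral.integral_mul_const,
      integral_inv_cosh hk.ne', integral_cosh_mul hk.ne', hkw, hsinh, ← hN]
    · field_simp
    · exact (continuous_const.div (by fun_prop)
        fun s => (Real.cosh_pos _).ne').intervalIntegrable _ _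
    · exact Continuous.intervalIntegrable (by fun_prop) _ _
  have hintnonneg : 0 ≤ N / k - α / l * c := by
    rw [← hint]
    refine intervalIntegral.integral_nonneg (by linarith) fun s hs => ?_
    have h1 := cosh_le_cosh_of_abs_le hk (abs_le.2 hs)
    have h2 := Real.cosh_pos (k * s)
    have h3 := Real.cosh_pos (k * (W / k))
    rw [sub_nonneg, hc, mul_one_div, div_le_div_iff₀ (by positivity) h2, one_mul]
    nlinarith
  rw [hint] at key
  obtain ⟨e, he⟩ : ∃ e : ℝ≥0, C.energy A F = e := ⟨_, (ENNReal.coe_toNNReal hE).symm⟩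
  have hαeq : C.area A = ENNReal.ofReal α := (ENNReal.ofReal_toReal harea.ne).symm
  rw [he, hαeq, ← ENNReal.ofReal_coe_nnreal, ← ENNReal.ofReal_mul hα0, ← ENNReal.ofReal_mul hl.le,
    ← ENNReal.ofReal_add (by positivity) (by positivity), ← ENNReal.ofReal_mul (by positivity),
    ← ENNReal.ofReal_mul (p := 1 / (N / k)) (by positivity),
    ← ENNReal.ofReal_add (by positivity) (by positivity),
    ← ENNReal.ofReal_ofNat 2, ← ENNReal.ofReal_mul zero_le_two,
    ENNReal.ofReal_le_ofReal_iff (by positivity)] at key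
  rw [he, ← ENNReal.ofReal_coe_nnreal]
  refine ENNReal.ofReal_le_ofReal ?_
  -- The two area terms cancel, because `l` times the integral of `cosh (k s)` over the collar is
  -- `α`.
  have h1 : 1 / (N / k) * (α * c + l * (N / k - α / l * c)) = l := by
    field_simp
    ring
  rw [h1] at key
  rw [div_le_iff₀ hNpos]
  have h2 : l ≤ N / k * e := by linarith
  rw [div_mul_eq_mul_div, le_div_iff₀ hk] at h2
  linarith

end Cylinder
end

noncomputable section

/-! ### Sharpness in constant curvature -/

/-- Passing to `arctan` turns an infinite end into a real one, so finite and infinite ends are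
treated alike. -/
theorem exists_lt_iff_lt_arctan {a : EReal} (ha : a ≠ ⊤) :
    ∃ α : ℝ, -(Real.pi / 2) ≤ α ∧ ∀ s : ℝ, a < s ↔ α < Real.arctan s := by
  induction a with
  | bot => exact ⟨-(Real.pi / 2), le_rfl, fun s =>
      ⟨fun _ => Real.neg_pi_div_two_lt_arctan s, fun _ => EReal.bot_lt_coe s⟩⟩
  | coe a => exact ⟨Real.arctan a, (Real.neg_pi_div_two_lt_arctan a).le, fun s => by
      rw [EReal.coe_lt_coe_iff, Real.arctan_lt_arctan_iff]⟩
  | top => exact absurd rfl ha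

theorem exists_lt_iff_arctan_lt {b : EReal} (hb : b ≠ ⊥) :
    ∃ β : ℝ, β ≤ Real.pi / 2 ∧ ∀ s : ℝ, s < b ↔ Real.arctan s < β := by
  induction b with
  | bot => exact absurd rfl hb
  | coe b => exact ⟨Real.arctan b, (Real.arctan_lt_pi_div_two b).le, fun s => by
      rw [EReal.coe_lt_coe_iff, Real.arctan_lt_arctan_iff]⟩
  | top => exact ⟨Real.pi / 2, le_rfl, fun s =>
      ⟨fun _ => Real.arctan_lt_pi_div_two s, fun _ => EReal.coe_lt_top s⟩⟩

/-- An interval with real or infinite ends is mapped onto `(-w, w)` by some increasing continuous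
function. -/
theorem exists_strictMono_image_eq_Ioo {a b : EReal} (hab : a < b) {w : ℝ} (hw : 0 < w) :
    ∃ g : ℝ → ℝ, Continuous g ∧ StrictMono g ∧
      g '' {s : ℝ | a < s ∧ (s : EReal) < b} = Set.Ioo (-w) w := by
  obtain ⟨α, hα, hαs⟩ := exists_lt_iff_lt_arctan (hab.trans_le le_top).ne
  obtain ⟨β, hβ, hβs⟩ := exists_lt_iff_arctan_lt (bot_le.trans_lt hab).ne'
  obtain ⟨s₀, hs₀a, hs₀b⟩ := EReal.lt_iff_exists_real_btwn.1 hab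
  have hαβ : 0 < β - α := sub_pos.2 (((hαs s₀).1 hs₀a).trans ((hβs s₀).1 hs₀b))
  have hm : 0 < 2 * w / (β - α) := by positivity
  refine ⟨fun s => 2 * w / (β - α) * (Real.arctan s - (α + β) / 2), by fun_prop,
    fun x y h => mul_lt_mul_of_pos_left (sub_lt_sub_right (Real.arctan_strictMono h) _) hm, ?_⟩
  have h1 : 2 * w / (β - α) * (α - (α + β) / 2) = -w := by field_simp; ring
  have h2 : 2 * w / (β - α) * (β - (α + β) / 2) = w := by field_simp; ring
  ext y
  constructor
  · rintro ⟨s, ⟨ha, hb⟩, rfl⟩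
    constructor
    · rw [← h1]
      exact mul_lt_mul_of_pos_left (sub_lt_sub_right ((hαs s).1 ha) _) hm
    · conv_rhs => rw [← h2]
      exact mul_lt_mul_of_pos_left (sub_lt_sub_right ((hβs s).1 hb) _) hm
  · rintro ⟨hy1, hy2⟩
    set z := y / (2 * w / (β - α)) + (α + β) / 2 with hz
    have hyz : 2 * w / (β - α) * (z - (α + β) / 2) = y := by
      rw [hz]; field_simp; ring
    have hzα : α < z := by
      by_contra! h
      have := mul_le_mul_of_nonneg_left (sub_le_sub_right h ((α + β) / 2)) hm.le
      rw [hyz, h1] at this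
      linarith
    have hzβ : z < β := by
      by_contra! h
      have := mul_le_mul_of_nonneg_left (sub_le_sub_right h ((α + β) / 2)) hm.le
      rw [hyz, h2] at this
      linarith
    have htan : Real.arctan (Real.tan z) = z := Real.arctan_tan (by linarith) (by linarith)
    exact ⟨Real.tan z, ⟨(hαs _).2 (by rwa [htan]), (hβs _).2 (by rwa [htan])⟩,
      by simp only [htan, hyz]⟩

theorem abs_h₁_sub_le (x y : ℝ) : |h₁ x - h₁ y| ≤ |x - y| := by
  have h := Convex.norm_image_sub_le_of_norm_hasDerivWithin_le (C := 1) (s := Set.univ)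
    (f := h₁) (fun x _ => (hasDerivAt_h₁ x).hasDerivWithinAt) (fun x _ => by
      rw [Real.norm_eq_abs, abs_of_pos (one_div_pos.2 (Real.cosh_pos x)),
        div_le_one (Real.cosh_pos x)]
      exact Real.one_le_cosh x) convex_univ (Set.mem_univ y) (Set.mem_univ x)
  simpa using h

/-! ### The collar of constant width and its potential -/

namespace Cylinder

variable {l : ℝ} (C : Cylinder l)

theorem lineMap_mem_Ioo {a b : EReal} {s r τ : ℝ} (hs : a < s ∧ (s : EReal) < b)
    (hr : a < r ∧ (r : EReal) < b) (hτ : τ ∈ Set.Icc (0 : ℝ) 1) :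
    a < ((AffineMap.lineMap s r τ : ℝ) : EReal) ∧ ((AffineMap.lineMap s r τ : ℝ) : EReal) < b := by
  have hI : AffineMap.lineMap s r τ ∈ Set.uIcc s r :=
    (convex_uIcc s r).lineMap_mem Set.left_mem_uIcc Set.right_mem_uIcc hτ
  rw [Set.mem_uIcc] at hI
  rcases hI with h | h
  · exact ⟨hs.1.trans_le (EReal.coe_le_coe_iff.2 h.1), (EReal.coe_le_coe_iff.2 h.2).trans_lt hr.2⟩
  · exact ⟨hr.1.trans_le (EReal.coe_le_coe_iff.2 h.1), (EReal.coe_le_coe_iff.2 h.2).trans_lt hs.2⟩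

theorem mem_Ioo_of_abs_lt {w s : ℝ} (ha : C.a ≤ ((-w : ℝ) : EReal)) (hb : (w : EReal) ≤ C.b)
    (hs : |s| < w) : C.a < s ∧ (s : EReal) < C.b := by
  obtain ⟨h1, h2⟩ := abs_lt.1 hs
  exact ⟨ha.trans_lt (EReal.coe_lt_coe_iff.2 h1), (EReal.coe_lt_coe_iff.2 h2).trans_le hb⟩

/-- An increasing `g` maps the range of heights onto `(-w, w)`. Interpolating linearly between `s`
and `g s` gives a strictly increasing map at each time, which therefore embeds the cylinder. -/
theorem isAnnulus_collar {w : ℝ} (hw : 0 < w) (ha : C.a ≤ ((-w : ℝ) : EReal))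
    (hb : (w : EReal) ≤ C.b) :
    C.IsAnnulus {p | |p.2| < w} {p | p.2 = -w} {p | p.2 = w} := by
  obtain ⟨g, hgc, hgm, hgI⟩ := exists_strictMono_image_eq_Ioo C.a_lt_b hw
  have hgw : ∀ s : ℝ, C.a < s → (s : EReal) < C.b → -w < g s ∧ g s < w := fun s hs hs' =>
    hgI.subset ⟨s, ⟨hs, hs'⟩, rfl⟩
  have hgmem : ∀ x : C.carrier, C.a < g x.1.2 ∧ (g x.1.2 : EReal) < C.b := fun x =>
    C.mem_Ioo_of_abs_lt ha hb (abs_lt.2 (hgw _ x.2.1 x.2.2))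
  let J : unitInterval → C.carrier → C.carrier := fun τ x =>
    ⟨(x.1.1, AffineMap.lineMap x.1.2 (g x.1.2) (τ : ℝ)), lineMap_mem_Ioo x.2 (hgmem x) τ.2⟩
  have hJ1 : (fun x => (J 1 x : AddCircle l × ℝ)) = fun x : C.carrier => (x.1.1, g x.1.2) := by
    ext x <;> simp [J]
  have himage : ∀ S : Set ℝ, (fun x => (J 1 x : AddCircle l × ℝ)) '' {x : C.carrier | x.1.2 ∈ S} =
      Set.univ ×ˢ (g '' ({s : ℝ | C.a < s ∧ (s : EReal) < C.b} ∩ S)) := by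
    intro S
    rw [hJ1]
    ext ⟨t, r⟩
    constructor
    · rintro ⟨x, hx, hxr⟩
      obtain ⟨rfl, rfl⟩ := Prod.mk.inj hxr
      exact ⟨trivial, x.1.2, ⟨x.2, hx⟩, rfl⟩
    · rintro ⟨-, s, ⟨hs, hsS⟩, rfl⟩
      exact ⟨⟨(t, s), hs⟩, hsS, rfl⟩
  refine ⟨J, ?_, fun τ => ?_, fun x => ?_, ?_, ?_, ?_⟩
  · refine Continuous.subtype_mk ((by fun_prop : Continuous fun x : unitInterval × C.carrier =>
      x.2.1.1).prodMk ?_) _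
    simp only [AffineMap.lineMap_apply, vsub_eq_sub, smul_eq_mul, vadd_eq_add]
    fun_prop
  · have hmono : StrictMono fun s => AffineMap.lineMap s (g s) (τ : ℝ) := by
      intro x y h
      have h1 := hgm h
      simp only [AffineMap.lineMap_apply, vsub_eq_sub, smul_eq_mul, vadd_eq_add]
      have h2 : 0 ≤ (τ : ℝ) := τ.2.1
      have h3 : (τ : ℝ) ≤ 1 := τ.2.2
      rcases h2.eq_or_lt with h4 | h4
      · rw [← h4]; linarith
      · nlinarith [mul_pos h4 (sub_pos.2 h1), mul_nonneg (sub_nonneg.2 h3) (sub_pos.2 h).le]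
    have hcont : Continuous fun s => AffineMap.lineMap s (g s) (τ : ℝ) := by
      simp only [AffineMap.lineMap_apply, vsub_eq_sub, smul_eq_mul, vadd_eq_add]
      fun_prop
    have hemb : Topology.IsEmbedding fun s => AffineMap.lineMap s (g s) (τ : ℝ) :=
      hmono.isEmbedding_of_ordConnected (isPreconnected_range hcont).ordConnected
    have hprod : Topology.IsEmbedding (Prod.map (id : AddCircle l → AddCircle l)
        fun s => AffineMap.lineMap s (g s) (τ : ℝ)) := Topology.IsEmbedding.id.prodMap hemb
    refine Topology.IsEmbedding.of_comp (g := Subtype.val) ?_ continuous_subtype_val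
      (hprod.comp Topology.IsEmbedding.subtypeVal)
    exact (hprod.continuous.comp continuous_subtype_val).subtype_mk _
  · refine Subtype.ext (Prod.ext rfl ?_)
    simp [J]
  · have h := himage Set.univ
    simp only [Set.mem_univ, Set.inter_univ, hgI] at h
    rw [← Set.image_univ]
    refine Eq.trans ?_ (h.symm.trans (by rfl))
    ext p
    exact ⟨fun hp => ⟨trivial, abs_lt.1 hp⟩, fun hp => abs_lt.2 hp.2⟩
  · have hc : ∀ c ∈ {c : ℝ | C.a < (c : EReal) ∧ (c : EReal) < C.b},
        closure ((fun x => (J 1 x : AddCircle l × ℝ)) '' {x : C.carrier | x.1.2 < c}) =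
          Set.univ ×ˢ Set.Icc (-w) (g c) := by
      intro c hc
      have h1 : g '' ({s : ℝ | C.a < s ∧ (s : EReal) < C.b} ∩ Set.Iio c) =
          Set.Ioo (-w) (g c) := by
        rw [Set.image_inter hgm.injective, hgI]
        ext y
        constructor
        · rintro ⟨hy, s, hs, rfl⟩
          exact ⟨hy.1, hgm hs⟩
        · rintro ⟨hy, hyc⟩
          have hyw : y ∈ Set.Ioo (-w) w := ⟨hy, hyc.trans (hgw c hc.1 hc.2).2⟩
          obtain ⟨s, hs, rfl⟩ := hgI.superset hyw
          exact ⟨hyw, s, hgm.lt_iff_lt.1 hyc, rfl⟩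
      have h2 := himage (Set.Iio c)
      rw [h1] at h2
      refine (congrArg closure h2).trans ?_
      rw [closure_prod_eq, closure_univ, closure_Ioo (hgw c hc.1 hc.2).1.ne]
    rw [Set.iInter₂_congr hc]
    ext p
    simp only [Set.mem_iInter]
    constructor
    · rintro (hp : p.2 = -w) c hcI
      exact ⟨trivial, hp.ge, hp ▸ (hgw c hcI.1 hcI.2).1.le⟩
    · intro h
      obtain ⟨s₀, hs₀a, hs₀b⟩ := EReal.lt_iff_exists_real_btwn.1 C.a_lt_b
      refine le_antisymm ?_ (h s₀ ⟨hs₀a, hs₀b⟩).2.1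
      by_contra! hlt
      -- A level `c` whose image lies strictly between `-w` and `p.2` excludes `p`.
      obtain ⟨y, hy1, hy2⟩ := exists_between (lt_min hlt (neg_lt_self hw))
      obtain ⟨c, hcI, rfl⟩ := hgI.superset ⟨hy1, hy2.trans_le (min_le_right _ _)⟩
      exact absurd (h c hcI).2.2 (not_le.2 (hy2.trans_le (min_le_left _ _)))
  · have hc : ∀ c ∈ {c : ℝ | C.a < (c : EReal) ∧ (c : EReal) < C.b},
        closure ((fun x => (J 1 x : AddCircle l × ℝ)) '' {x : C.carrier | c < x.1.2}) =
          Set.univ ×ˢ Set.Icc (g c) w := by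
      intro c hc
      have h1 : g '' ({s : ℝ | C.a < s ∧ (s : EReal) < C.b} ∩ Set.Ioi c) =
          Set.Ioo (g c) w := by
        rw [Set.image_inter hgm.injective, hgI]
        ext y
        constructor
        · rintro ⟨hy, s, hs, rfl⟩
          exact ⟨hgm hs, hy.2⟩
        · rintro ⟨hyc, hy⟩
          have hyw : y ∈ Set.Ioo (-w) w := ⟨(hgw c hc.1 hc.2).1.trans hyc, hy⟩
          obtain ⟨s, hs, rfl⟩ := hgI.superset hyw
          exact ⟨hyw, s, hgm.lt_iff_lt.1 hyc, rfl⟩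
      have h2 := himage (Set.Ioi c)
      rw [h1] at h2
      refine (congrArg closure h2).trans ?_
      rw [closure_prod_eq, closure_univ, closure_Ioo (hgw c hc.1 hc.2).2.ne]
    rw [Set.iInter₂_congr hc]
    ext p
    simp only [Set.mem_iInter]
    constructor
    · rintro (hp : p.2 = w) c hcI
      exact ⟨trivial, hp ▸ (hgw c hcI.1 hcI.2).2.le, hp.le⟩
    · intro h
      obtain ⟨s₀, hs₀a, hs₀b⟩ := EReal.lt_iff_exists_real_btwn.1 C.a_lt_b
      refine le_antisymm (h s₀ ⟨hs₀a, hs₀b⟩).2.2 ?_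
      by_contra! hlt
      obtain ⟨y, hy1, hy2⟩ := exists_between (max_lt hlt (neg_lt_self hw))
      obtain ⟨c, hcI, rfl⟩ := hgI.superset ⟨(le_max_right _ _).trans_lt hy1, hy2⟩
      exact absurd (h c hcI).2.1 (not_le.2 ((le_max_left _ _).trans_lt hy1))

theorem coordSet_collar (w : ℝ) :
    coordSet {p : AddCircle l × ℝ | |p.2| < w} = Set.Ico 0 l ×ˢ Set.Ioo (-w) w := by
  ext p
  exact ⟨fun h => ⟨⟨h.1, h.2.1⟩, abs_lt.1 h.2.2⟩, fun h => ⟨h.1.1, h.1.2, abs_lt.2 h.2⟩⟩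

theorem lintegral_collar {w : ℝ} (hw : 0 ≤ w) {D : ℝ × ℝ → ℝ} {g : ℝ → ℝ} (hg : Continuous g)
    (hpos : ∀ s, 0 ≤ g s) (hD : ∀ p ∈ Set.Ico 0 l ×ˢ Set.Ioo (-w) w, D p = g p.2) :
    ∫⁻ p in coordSet {p : AddCircle l × ℝ | |p.2| < w}, ENNReal.ofReal (D p) =
      ENNReal.ofReal l * ENNReal.ofReal (∫ s in -w..w, g s) := by
  rw [coordSet_collar, MeasureTheory.setLIntegral_congr_fun
    (measurableSet_Ico.prod measurableSet_Ioo) (g := fun p => ENNReal.ofReal (g p.2))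
    (fun p hp => by simp only [hD p hp]),
    setLIntegral_strip (g := fun s => ENNReal.ofReal (g s)) hg.measurable.ennreal_ofReal,
    MeasureTheory.Measure.restrict_congr_set MeasureTheory.Ioo_ae_eq_Icc,
    setLIntegral_Icc_ofReal hw hg fun s _ => hpos s]

variable {C}

theorem sqrt_det_eq_cosh {k : ℝ} (hK : ∀ p ∈ C.strip, gaussCurvature C.G p = -k ^ 2)
    {p : ℝ × ℝ} (hp : p ∈ C.strip) : Real.sqrt (C.G p).det = Real.cosh (k * p.2) := by
  refine le_antisymm ?_ (cosh_le_sqrt_det (fun q hq => (hK q hq).le) hp)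
  rw [sqrt_det_metric hp]
  have := C.lengthElement_comparison (k := k) (ε := -1) (t := p.1) hp.1.le hp.2.le
    fun q hq => by rw [hK q hq]; simp
  linarith

theorem area_collar {k : ℝ} (hk : 0 < k)
    (hK : ∀ p ∈ C.strip, gaussCurvature C.G p = -k ^ 2) {w : ℝ} (hw : 0 < w)
    (ha : C.a ≤ ((-w : ℝ) : EReal)) (hb : (w : EReal) ≤ C.b) :
    C.area {p | |p.2| < w} =
      ENNReal.ofReal l * ENNReal.ofReal (2 * Real.sinh (k * w) / k) := by
  rw [← integral_cosh_mul hk.ne']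
  refine lintegral_collar hw.le (by fun_prop) (fun s => (Real.cosh_pos _).le) fun p hp => ?_
  exact sqrt_det_eq_cosh hK (C.mem_Ioo_of_abs_lt ha hb (abs_lt.2 hp.2))

/-- The potential of the collar of width `w` in curvature `-k ^ 2`. -/
def collarPotential (k w : ℝ) (x : AddCircle l × ℝ) : ℝ :=
  (h₁ (k * x.2) - h₁ (-(k * w))) / (h₁ (k * w) - h₁ (-(k * w)))

theorem h₁_sub_pos {x : ℝ} (hx : 0 < x) : 0 < h₁ x - h₁ (-x) :=
  sub_pos.2 (h₁_strictMono (by linarith))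

/-- Both maps involved are Lipschitz: `h₁` has derivative `1 / cosh ≤ 1`, and the height does not
change by more than the Riemannian distance. -/
theorem isLip_collarPotential {k w : ℝ} (hk : 0 < k) (hw : 0 < w)
    (X : Set (AddCircle l × ℝ)) : C.IsLip X (collarPotential k w) := by
  have hN := h₁_sub_pos (mul_pos hk hw)
  refine ⟨(k / (h₁ (k * w) - h₁ (-(k * w)))).toNNReal, fun x _ y _ => ?_⟩
  refine le_trans ?_ (mul_le_mul_right (C.abs_sub_le_dist x y) _)
  rw [edist_dist, Real.dist_eq, ← ENNReal.ofReal, ← ENNReal.ofReal_mul (by positivity)]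
  refine ENNReal.ofReal_le_ofReal ?_
  rw [collarPotential, collarPotential, ← sub_div, abs_div, abs_of_pos hN, div_mul_eq_mul_div]
  refine div_le_div_of_nonneg_right ?_ hN.le
  rw [sub_sub_sub_cancel_right]
  refine (abs_h₁_sub_le _ _).trans ?_
  rw [← mul_sub, abs_mul, abs_of_pos hk]

theorem pd_collarPotential (k w : ℝ) (i : Fin 2) (p : ℝ × ℝ) :
    pd i (fun q => collarPotential k w ((q.1 : AddCircle l), q.2)) p =
      ![0, k / Real.cosh (k * p.2) / (h₁ (k * w) - h₁ (-(k * w)))] i := by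
  have h1 : HasDerivAt (fun s => (h₁ (k * s) - h₁ (-(k * w))) / (h₁ (k * w) - h₁ (-(k * w))))
      (k / Real.cosh (k * p.2) / (h₁ (k * w) - h₁ (-(k * w)))) p.2 := by
    have h := (((hasDerivAt_h₁ (k * p.2)).comp p.2
      ((hasDerivAt_id p.2).const_mul k)).sub_const (h₁ (-(k * w)))).div_const
        (h₁ (k * w) - h₁ (-(k * w)))
    refine h.congr_deriv ?_
    ring
  have h2 := h1.comp_hasFDerivAt p (hasFDerivAt_snd (𝕜 := ℝ) (E := ℝ) (F := ℝ) (p := p))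
  have h3 : fderiv ℝ (fun q : ℝ × ℝ => collarPotential k w ((q.1 : AddCircle l), q.2)) p = _ :=
    h2.fderiv
  rw [pd, h3]
  fin_cases i <;> simp

/-- The energy density is `(k / N)² / cosh (k s)`, and the integral of `1 / cosh (k s)` over the
collar is `l N / k`. -/
theorem energy_collarPotential {k : ℝ} (hk : 0 < k) (hl : 0 < l)
    (hK : ∀ p ∈ C.strip, gaussCurvature C.G p = -k ^ 2) {w : ℝ} (hw : 0 < w)
    (ha : C.a ≤ ((-w : ℝ) : EReal)) (hb : (w : EReal) ≤ C.b) :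
    C.energy {p | |p.2| < w} (collarPotential k w) =
      ENNReal.ofReal (k * l / (h₁ (k * w) - h₁ (-(k * w)))) := by
  have hN := h₁_sub_pos (mul_pos hk hw)
  set N := h₁ (k * w) - h₁ (-(k * w)) with hNdef
  have hc : Continuous fun s => (k / N) ^ 2 * (1 / Real.cosh (k * s)) :=
    continuous_const.mul (continuous_const.div (by fun_prop) fun s => (Real.cosh_pos _).ne')
  have h := lintegral_collar (l := l) (w := w) hw.le (D := fun p => (∑ i, ∑ j, (C.G p)⁻¹ i j *
    pd i (fun q => collarPotential k w ((q.1 : AddCircle l), q.2)) p *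
    pd j (fun q => collarPotential k w ((q.1 : AddCircle l), q.2)) p) * Real.sqrt (C.G p).det)
    hc (fun s => by have := Real.cosh_pos (k * s); positivity) (fun p hp => by
      have hp' : p ∈ C.strip := C.mem_Ioo_of_abs_lt ha hb (abs_lt.2 hp.2)
      have h1 := energyDensity_eq hp'
        fun i => pd i (fun q => collarPotential k w ((q.1 : AddCircle l), q.2)) p
      refine h1.trans ?_
      rw [sqrt_det_eq_cosh hK hp', pd_collarPotential, pd_collarPotential]
      have := Real.cosh_pos (k * p.2)
      simp only [Matrix.cons_val_zero, Matrix.cons_val_one, ← hNdef]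
      field_simp
      simp)
  refine h.trans ?_
  rw [intervalIntegral.integral_const_mul, integral_inv_cosh hk.ne', ← ENNReal.ofReal_mul hl.le,
    ← hNdef]
  congr 1
  field_simp

theorem capacityBound_area_collar {k : ℝ} (hk : 0 < k) (hl : 0 < l)
    (hK : ∀ p ∈ C.strip, gaussCurvature C.G p = -k ^ 2) {w : ℝ} (hw : 0 < w)
    (ha : C.a ≤ ((-w : ℝ) : EReal)) (hb : (w : EReal) ≤ C.b) :
    capacityBound k l (C.area {p | |p.2| < w}).toReal =
      k * l / (h₁ (k * w) - h₁ (-(k * w))) := by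
  have hs : 0 < Real.sinh (k * w) := Real.sinh_pos_iff.2 (mul_pos hk hw)
  rw [area_collar hk hK hw ha hb, ← ENNReal.ofReal_mul hl.le,
    ENNReal.toReal_ofReal (by positivity), capacityBound]
  have h : k * (l * (2 * Real.sinh (k * w) / k)) / (2 * l) = Real.sinh (k * w) := by
    field_simp
  rw [h, Real.arsinh_sinh]

end Cylinder

end

/-! ### The capacity bound and its sharpness -/

theorem theorem1 (k l : ℝ) (hk : 0 < k) (hl : 0 < l) (C : Cylinder l)
    (hK : ∀ t s : ℝ, C.a < (s : EReal) → (s : EReal) < C.b →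
      gaussCurvature C.G (t, s) ≤ -k ^ 2) :
    (∀ A B₁ B₂ : Set (AddCircle l × ℝ), C.IsAnnulus A B₁ B₂ → C.area A < ⊤ →
      ENNReal.ofReal (capacityBound k l (C.area A).toReal) ≤ C.capacity A B₁ B₂) ∧
    ((∀ t s : ℝ, C.a < (s : EReal) → (s : EReal) < C.b →
        gaussCurvature C.G (t, s) = -k ^ 2) →
      ∀ w : ℝ, 0 < w → C.a ≤ ((-w : ℝ) : EReal) → (w : EReal) ≤ C.b →
        C.IsAnnulus {p | |p.2| < w} {p | p.2 = -w} {p | p.2 = w} ∧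
        C.area {p | |p.2| < w} < ⊤ ∧
        C.capacity {p | |p.2| < w} {p | p.2 = -w} {p | p.2 = w} =
          ENNReal.ofReal (capacityBound k l (C.area {p | |p.2| < w}).toReal)) := by
  have lower : ∀ A B₁ B₂ : Set (AddCircle l × ℝ), C.IsAnnulus A B₁ B₂ → C.area A < ⊤ →
      ENNReal.ofReal (capacityBound k l (C.area A).toReal) ≤ C.capacity A B₁ B₂ :=
    fun A B₁ B₂ hann harea => le_iInf₂ fun F hF => le_iInf₂ fun hB₁ hB₂ =>
      Cylinder.ofReal_capacityBound_le_energy hk hl (fun p hp => hK p.1 p.2 hp.1 hp.2) hann harea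
        hF hB₁ hB₂
  refine ⟨lower, fun hKeq w hw ha hb => ?_⟩
  have hK' : ∀ p ∈ C.strip, gaussCurvature C.G p = -k ^ 2 := fun p hp =>
    hKeq p.1 p.2 hp.1 hp.2
  have hann := C.isAnnulus_collar hw ha hb
  have harea : C.area {p | |p.2| < w} < ⊤ := by
    rw [Cylinder.area_collar hk hK' hw ha hb]
    exact ENNReal.mul_lt_top ENNReal.ofReal_lt_top ENNReal.ofReal_lt_top
  have hN := Cylinder.h₁_sub_pos (mul_pos hk hw)
  refine ⟨hann, harea, le_antisymm ?_ (lower _ _ _ hann harea)⟩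
  rw [Cylinder.capacityBound_area_collar hk hl hK' hw ha hb,
    ← Cylinder.energy_collarPotential hk hl hK' hw ha hb]
  refine (iInf₂_le (Cylinder.collarPotential k w)
    (Cylinder.isLip_collarPotential hk hw _)).trans (iInf₂_le ?_ ?_)
  · rintro x (hx : x.2 = -w)
    rw [Cylinder.collarPotential, hx, mul_neg, sub_self, zero_div]
  · rintro x (hx : x.2 = w)
    rw [Cylinder.collarPotential, hx, div_self hN.ne']
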